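/- **Service placement with set constraints (SPSC).** Let $S$ (services) and $V$ (nodes) be finite nonempty sets and $U$ a finite set (users). Service $i$ has size $s_i>0$, node $j$ has capacity $c_j>0$; user $k$ requires a service $i_k\in S$, has a set $T_k\subseteq V$ and a reward $w_k\ge 0$. A placement $X=(X_i)_{i\in S}$, $X_i\subseteq V$, is feasible if $\sum_{i:\,j\in X_i}s_i\le c_j$ for all $j$; its reward is $\sum_{k:\,T_k\cap X_{i_k}\neq\emptyset}w_k$. Let $R$ be the maximal reward of a feasible placement. $X$ has approximation ratio $\rho$ if $\rho R\le \mathrm{reward}(X)\le R$. Put $\mathbb N=\{1,2,\dots\}$. **LP.** Both SA1 and SA2 start from any optimal solution $(p,r)$ of: maximize $\sum_k r_kw_k$ subject to $0\le r_k\le 1$, $r_k\le\sum_{j\in T_k}p_{i_kj}$, $\sum_i p_{ij}s_i\le c_j$, $0\le p_{ij}\le1$, and $p_{ij}=0$ if $s_i>c_j$. **Classes.** For $0<\beta<1$ let $\gamma=1-\sqrt\beta$, $\delta=(1-\sqrt\beta)^2$, $P_{jq}=\{i:\gamma^qc_j\beta<s_i\le\gamma^{q-1}c_j\beta\}$ for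 $q\in\mathbb N$, $P_{j\oplus}=\{i:\frac12c_j<s_i\le c_j\}$, $P_{j\ominus}=\{i:c_j\beta<s_i\le\frac12c_j\}$, and $d_{jq}=\sum_{i\in P_{jq}}p_{ij}$ for every label $q\in\mathbb N\cup\{\oplus,\ominus\}$. A slot $\sigma$ has a node $v(\sigma)$ and a label $l(\sigma)$; write $P_\sigma=P_{v(\sigma)l(\sigma)}$, $d_\sigma=d_{v(\sigma)l(\sigma)}$. Quotients $x/0$ are read as $0$. **Filling slots.** For a finite set $\Lambda$ of slots and a partial assignment $\tau$ of services to slots, let $f_k(\tau)=1$ if some $\sigma\in\Lambda$ has $v(\sigma)\in T_k$ and $\tau(\sigma)=i_k$, and otherwise $f_k(\tau)=1-\prod_\sigma(1-p_{i_kv(\sigma)}/d_\sigma)$ over the empty $\sigma\in\Lambda$ with $v(\sigma)\in T_k$, $i_k\in P_\sigma$. Start with all slots empty; for the slots $\sigma\in\Lambda$ one after the other, in any order, assign to $\sigma$ a service in $P_\sigma$ for which $\sum_k f_k(\tau)w_k$ after the assignment is maximal (if $P_\sigma=\emptyset$, leave $\sigma$ empty). Output: $j\in X_i$ iff some slot on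 $j$ holds $i$. **SA1** (parameter $\beta<1$). On node $j$ create $\lceil \nu_jd_{jq}\rceil$ slots of label $q$ for each $q\in\mathbb N$ with $P_{jq}\ne\emptyset$, where $\nu_j=\delta c_j/\sum_i s_ip_{ij}$; then fill the slots. **SA2** ($\beta=\delta=\frac14$, $\gamma=\frac12$). Let $n_{jq}=\lceil\nu_jd_{jq}\rceil$ with $\nu_j=\delta c_j/\sum_{i:\,s_i\le c_j\beta}s_ip_{ij}$, and $m_j=d_{j\ominus}$ if $d_{j\ominus}<2$, $m_j=d_{j\ominus}/2$ otherwise. Let $\rho_{ij1}=p_{ij}/d_{j\oplus}$ if $i\in P_{j\oplus}$, $\rho_{ij2}=1-(1-p_{ij}/d_{j\ominus})^2$ if $i\in P_{j\ominus}$, $\rho_{ij3}=1-(1-p_{ij}/d_{jq})^{n_{jq}}$ if $i\in P_{jq}$, $q\in\mathbb N$; all other $\rho_{ija}$, $a\in\{1,2,3\}$, are $0$; and $\rho_{ij\emptyset}=\delta d_{j\oplus}\rho_{ij1}+\delta m_j\rho_{ij2}+(1-\delta d_{j\oplus}-\delta m_j)\rho_{ij3}$. Start with $\zeta(j)=\emptyset$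 for all $j$; for the nodes one after the other, in any order, replace $\zeta(j)$ by a value in $\{1,2,3\}$ for which $\sum_k w_k\bigl(1-\prod_{j'\in T_k}(1-\rho_{i_kj'\zeta(j')})\bigr)$ is maximal. Then create on node $j$: one slot of label $\oplus$ if $\zeta(j)=1$; two slots of label $\ominus$ if $\zeta(j)=2$; $n_{jq}$ slots of label $q$ for each $q\in\mathbb N$ with $P_{jq}\neq\emptyset$ if $\zeta(j)=3$. Fill the slots. **CSA.** Let $\beta$ be the least number with $\max_is_i\le\beta\min_jc_j$. If $\beta\ge1$ (or no such number exists, because a capacity is $0$) or $(1-e^{-1})/4>1-e^{-(1-\sqrt\beta)^2}$, run SA2; otherwise run SA1 with parameter $\beta$. **RSA.** Start with $Y_i=\emptyset$, $U'=U$, $c'=c$. Repeat until an iteration leaves $Y$ unchanged: run CSA with users $U'$ and capacities $c'$, let $X$ be its output; replace $U'$ by $\{k\in U':X_{i_k}\cap T_k=\emptyset\}$, $c'_j$ by $c'_j-\sum_{i:\,j\in X_i}s_i$, and $Y_i$ by $Y_i\cup X_i$. Output $Y$. **Theorem.** Let $\beta=\max_is_i/\min_jc_j$ and $$\rho=\begin{cases}\max\{1-e^{-(1-\sqrt\beta)^2},\,(1-e^{-1})/4\}&\text{if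 }\beta<1,\\(1-e^{-1})/4&\text{if }\beta\ge1.\end{cases}$$ For all choices of LP optima, processing orders and tie-breaking: CSA returns a placement, RSA never gets stuck and stops after finitely many iterations, and both return a feasible placement with approximation ratio $\rho$. The first iteration of RSA yields an output of CSA, and no iteration of RSA decreases the reward of $Y$; so the reward of the output of RSA is at least that of the CSA placement found in its first iteration. -/

import Mathlib

/-- Data of an instance of service placement with set constraints: services `S`, nodes `V`,
a finite set `users` of users (elements of `U`), service sizes, node capacities, the service
required by each user, the set of nodes that can satisfy each user, and the users' rewards. -/
structure SPSC (S V U : Type*) where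
  users : Finset U
  size : S → ℝ
  cap : V → ℝ
  service : U → S
  nodes : U → Finset V
  weight : U → ℝ

/-- The labels of slots: a level `q`, or one of the two special labels `⊕` and `⊖`. -/
inductive SlotLabel where
  | level (q : ℕ)
  | plus
  | minus

/-- A slot lives on a node and has a label; `idx` distinguishes slots with equal node and label. -/
structure Slot (V : Type*) where
  node : V
  label : SlotLabel
  idx : ℕ

/-- The values `1`, `2`, `3` of a construction map. -/
inductive NodeMode where
  | one
  | two
  | three

noncomputable section

namespace SPSC

section Algorithms

open scoped Classical

variable {S V U : Type*} [Fintype S] [Fintype V]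

/-! ### The optimization problem -/

/-- A service placement `X` (where `X i` is the set of nodes that hold `i`) is feasible if no
capacity is exceeded. -/
def Feasible (I : SPSC S V U) (X : S → Finset V) : Prop :=
  ∀ j, ∑ i, (if j ∈ X i then I.size i else 0) ≤ I.cap j

/-- User `k` is satisfied by `X`. -/
def Satisfied (I : SPSC S V U) (X : S → Finset V) (k : U) : Prop :=
  (I.nodes k ∩ X (I.service k)).Nonempty

/-- Total reward of a service placement. -/
def reward (I : SPSC S V U) (X : S → Finset V) : ℝ :=
  ∑ k ∈ I.users, if I.Satisfied X k then I.weight k else 0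

/-- The optimal value (a maximum over finitely many placements, see `isGreatest_opt`). -/
def opt (I : SPSC S V U) : ℝ := sSup (I.reward '' {X | I.Feasible X})

theorem isGreatest_opt (I : SPSC S V U) (hc : ∀ j, 0 ≤ I.cap j) :
    IsGreatest (I.reward '' {X | I.Feasible X}) I.opt := by
  have hne : (I.reward '' {X | I.Feasible X}).Nonempty :=
    ⟨_, fun _ => ∅, fun j => by simpa using hc j, rfl⟩
  have hfin : (I.reward '' {X | I.Feasible X}).Finite := (Set.toFinite _).image _
  exact ⟨hne.csSup_mem hfin, fun x hx => le_csSup hfin.bddAbove hx⟩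

/-! ### The linear program -/

/-- The constraints of the linear program (in the variables `p i j` and `r k`). -/
structure LPFeasible (I : SPSC S V U) (p : S → V → ℝ) (r : U → ℝ) : Prop where
  r_nonneg : ∀ k ∈ I.users, 0 ≤ r k
  r_le_sum : ∀ k ∈ I.users, r k ≤ ∑ j ∈ I.nodes k, p (I.service k) j
  r_le_one : ∀ k ∈ I.users, r k ≤ 1
  cap_le : ∀ j, ∑ i, p i j * I.size i ≤ I.cap j
  too_large : ∀ i j, I.cap j < I.size i → p i j = 0
  p_nonneg : ∀ i j, 0 ≤ p i j
  p_le_one : ∀ i j, p i j ≤ 1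

def LPOptimal (I : SPSC S V U) (p : S → V → ℝ) (r : U → ℝ) : Prop :=
  I.LPFeasible p r ∧ ∀ p' r', I.LPFeasible p' r' →
    ∑ k ∈ I.users, r' k * I.weight k ≤ ∑ k ∈ I.users, r k * I.weight k

/-- `p` is (the relevant part of) an optimal solution of the linear program. -/
def IsLPSolution (I : SPSC S V U) (p : S → V → ℝ) : Prop := ∃ r, I.LPOptimal p r

/-! ### Size classes -/

def gamma (β : ℝ) : ℝ := 1 - √β

def delta (β : ℝ) : ℝ := (1 - √β) ^ 2

/-- The services that may occupy a slot with a given label on node `j`. Levels are numbered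
from `1`; the label `level 0` is not used, and its class is empty. -/
def sizeClass (I : SPSC S V U) (β : ℝ) (j : V) : SlotLabel → Finset S
  | .level q => Finset.univ.filter fun i => 1 ≤ q ∧
      gamma β ^ q * I.cap j * β < I.size i ∧ I.size i ≤ gamma β ^ (q - 1) * I.cap j * β
  | .plus => Finset.univ.filter fun i => 1 / 2 * I.cap j < I.size i ∧ I.size i ≤ I.cap j
  | .minus => Finset.univ.filter fun i =>
      I.cap j * β < I.size i ∧ I.size i ≤ 1 / 2 * I.cap j

/-- The total fractional amount `d` of a size class. -/
def classMass (I : SPSC S V U) (β : ℝ) (p : S → V → ℝ) (j : V) (l : SlotLabel) : ℝ :=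
  ∑ i ∈ I.sizeClass β j l, p i j

/-! ### Greedy filling of slots, common to both slot allocation algorithms

Slot allocations are functions `Slot V → Option S`, where `none` stands for an empty slot. -/

/-- Computed satisfaction probability of user `k`, given the partial slot allocation `τ`.
(For a class of mass `0` the quotient is `0`.) -/
def satProb (I : SPSC S V U) (β : ℝ) (p : S → V → ℝ) (L : List (Slot V))
    (τ : Slot V → Option S) (k : U) : ℝ :=
  if ∃ σ ∈ L, σ.node ∈ I.nodes k ∧ τ σ = some (I.service k) then 1
  else 1 - ∏ σ ∈ L.toFinset.filter fun σ => σ.node ∈ I.nodes k ∧ τ σ = none ∧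
      I.service k ∈ I.sizeClass β σ.node σ.label,
    (1 - p (I.service k) σ.node / I.classMass β p σ.node σ.label)

/-- Computed expected reward, given the partial slot allocation `τ`. -/
def expReward (I : SPSC S V U) (β : ℝ) (p : S → V → ℝ) (L : List (Slot V))
    (τ : Slot V → Option S) : ℝ :=
  ∑ k ∈ I.users, I.satProb β p L τ k * I.weight k

/-- `I.FillRun β p L todo τ ψ`: processing the slots in `todo` in this order, starting from the
partial slot allocation `τ`, can end in `ψ`. Each slot receives a service of its class that
maximizes the expected reward (ties are broken arbitrarily). A slot whose class is empty stays
empty. -/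
inductive FillRun (I : SPSC S V U) (β : ℝ) (p : S → V → ℝ) (L : List (Slot V)) :
    List (Slot V) → (Slot V → Option S) → (Slot V → Option S) → Prop
  | done (τ : Slot V → Option S) : FillRun I β p L [] τ τ
  | fill (σ : Slot V) (todo : List (Slot V)) (τ ψ : Slot V → Option S) (i : S)
      (hi : i ∈ I.sizeClass β σ.node σ.label)
      (hmax : ∀ i' ∈ I.sizeClass β σ.node σ.label,
        I.expReward β p L (Function.update τ σ (some i')) ≤
          I.expReward β p L (Function.update τ σ (some i)))
      (hrest : FillRun I β p L todo (Function.update τ σ (some i)) ψ) :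
      FillRun I β p L (σ :: todo) τ ψ
  | skip (σ : Slot V) (todo : List (Slot V)) (τ ψ : Slot V → Option S)
      (hempty : I.sizeClass β σ.node σ.label = ∅)
      (hrest : FillRun I β p L todo τ ψ) :
      FillRun I β p L (σ :: todo) τ ψ

/-- The service placement associated with a slot allocation `ψ` on the slots `L`. -/
def placementOf (L : List (Slot V)) (ψ : Slot V → Option S) (i : S) : Finset V :=
  Finset.univ.filter fun j => ∃ σ ∈ L, σ.node = j ∧ ψ σ = some i

/-- `X` is a possible result of greedily filling the set of slots `Λ` (in any order). -/
def IsFillOutput (I : SPSC S V U) (β : ℝ) (p : S → V → ℝ) (Λ : Set (Slot V))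
    (X : S → Finset V) : Prop :=
  ∃ (L : List (Slot V)) (ψ : Slot V → Option S), L.Nodup ∧ (∀ σ, σ ∈ L ↔ σ ∈ Λ) ∧
    I.FillRun β p L L (fun _ => none) ψ ∧ X = placementOf L ψ

/-! ### The first slot allocation algorithm -/

/-- The number of slots of label `level q` on node `j` in the first algorithm. (If the
denominator of the first factor is `0`, the class mass is `0` too, and there are no slots.) -/
def numSlots1 (I : SPSC S V U) (β : ℝ) (p : S → V → ℝ) (j : V) (q : ℕ) : ℕ :=
  ⌈delta β * I.cap j / (∑ i, I.size i * p i j) * I.classMass β p j (.level q)⌉₊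

def slots1 (I : SPSC S V U) (β : ℝ) (p : S → V → ℝ) : Set (Slot V) :=
  {σ | ∃ q, 1 ≤ q ∧ σ.label = .level q ∧ (I.sizeClass β σ.node (.level q)).Nonempty ∧
    σ.idx < I.numSlots1 β p σ.node q}

/-- `X` is a possible output of the first slot allocation algorithm with parameter `β`. -/
def IsSA1Output (I : SPSC S V U) (β : ℝ) (X : S → Finset V) : Prop :=
  ∃ p, I.IsLPSolution p ∧ I.IsFillOutput β p (I.slots1 β p) X

/-! ### The second slot allocation algorithm (where `β = 1/4`, `γ = 1/2`, `δ = 1/4`) -/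

/-- The number of slots of label `level q` on a node `j` of mode `three`. -/
def numSlots2 (I : SPSC S V U) (p : S → V → ℝ) (j : V) (q : ℕ) : ℕ :=
  ⌈delta (1 / 4) * I.cap j /
      (∑ i ∈ Finset.univ.filter (fun i => I.size i ≤ I.cap j * (1 / 4)), I.size i * p i j) *
    I.classMass (1 / 4) p j (.level q)⌉₊

/-- The quantity that gives, multiplied by `δ`, the probability of mode `two`. -/
def midMass (I : SPSC S V U) (p : S → V → ℝ) (j : V) : ℝ :=
  if I.classMass (1 / 4) p j .minus < 2 then I.classMass (1 / 4) p j .minus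
  else I.classMass (1 / 4) p j .minus / 2

/-- Computed probability that service `i` is placed on node `j`, given the mode of `j`. -/
def placeProbMode (I : SPSC S V U) (p : S → V → ℝ) (i : S) (j : V) : NodeMode → ℝ
  | .one =>
      if i ∈ I.sizeClass (1 / 4) j .plus then p i j / I.classMass (1 / 4) p j .plus else 0
  | .two =>
      if i ∈ I.sizeClass (1 / 4) j .minus then
        1 - (1 - p i j / I.classMass (1 / 4) p j .minus) ^ 2 else 0
  | .three =>
      if h : ∃ q, i ∈ I.sizeClass (1 / 4) j (.level q) then
        1 - (1 - p i j / I.classMass (1 / 4) p j (.level h.choose)) ^ I.numSlots2 p j h.choose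
      else 0

/-- The same, where `none` means that the mode of `j` is not chosen yet. -/
def placeProb (I : SPSC S V U) (p : S → V → ℝ) (i : S) (j : V) : Option NodeMode → ℝ
  | some a => I.placeProbMode p i j a
  | none =>
      delta (1 / 4) * I.classMass (1 / 4) p j .plus * I.placeProbMode p i j .one +
      delta (1 / 4) * I.midMass p j * I.placeProbMode p i j .two +
      (1 - delta (1 / 4) * I.classMass (1 / 4) p j .plus - delta (1 / 4) * I.midMass p j) *
        I.placeProbMode p i j .three

/-- Computed expected reward, given a partial construction map `ζ`. -/
def expRewardMap (I : SPSC S V U) (p : S → V → ℝ) (ζ : V → Option NodeMode) : ℝ :=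
  ∑ k ∈ I.users, (1 - ∏ j ∈ I.nodes k, (1 - I.placeProb p (I.service k) j (ζ j))) * I.weight k

/-- `I.ModeRun p todo ζ lam`: processing the nodes in `todo` in this order, starting from the
partial construction map `ζ`, can end in `lam`. Each node receives a mode that maximizes the
expected reward (ties are broken arbitrarily). -/
inductive ModeRun (I : SPSC S V U) (p : S → V → ℝ) :
    List V → (V → Option NodeMode) → (V → Option NodeMode) → Prop
  | done (ζ : V → Option NodeMode) : ModeRun I p [] ζ ζ
  | choose (j : V) (todo : List V) (ζ lam : V → Option NodeMode) (a : NodeMode)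
      (hmax : ∀ a', I.expRewardMap p (Function.update ζ j (some a')) ≤
        I.expRewardMap p (Function.update ζ j (some a)))
      (hrest : ModeRun I p todo (Function.update ζ j (some a)) lam) :
      ModeRun I p (j :: todo) ζ lam

/-- The slots created from the construction map `lam`. -/
def slots2 (I : SPSC S V U) (p : S → V → ℝ) (lam : V → Option NodeMode) : Set (Slot V) :=
  {σ | (lam σ.node = some .one ∧ σ.label = .plus ∧ σ.idx < 1) ∨
    (lam σ.node = some .two ∧ σ.label = .minus ∧ σ.idx < 2) ∨
    (lam σ.node = some .three ∧ ∃ q, 1 ≤ q ∧ σ.label = .level q ∧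
      (I.sizeClass (1 / 4) σ.node (.level q)).Nonempty ∧ σ.idx < I.numSlots2 p σ.node q)}

/-- `X` is a possible output of the second slot allocation algorithm. -/
def IsSA2Output (I : SPSC S V U) (X : S → Finset V) : Prop :=
  ∃ p, I.IsLPSolution p ∧ ∃ (todo : List V) (lam : V → Option NodeMode),
    todo.Nodup ∧ (∀ j, j ∈ todo) ∧ I.ModeRun p todo (fun _ => none) lam ∧
    I.IsFillOutput (1 / 4) p (I.slots2 p lam) X

/-! ### The combined algorithm and its repetition -/

variable [Nonempty S] [Nonempty V]

def maxSize (I : SPSC S V U) : ℝ := Finset.univ.sup' Finset.univ_nonempty I.size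

def minCap (I : SPSC S V U) : ℝ := Finset.univ.inf' Finset.univ_nonempty I.cap

/-- The least `b` with `maxSize ≤ b * minCap`, if the smallest capacity is positive. -/
def beta (I : SPSC S V U) : ℝ := I.maxSize / I.minCap

theorem isLeast_beta (I : SPSC S V U) (h : 0 < I.minCap) :
    IsLeast {b : ℝ | I.maxSize ≤ b * I.minCap} I.beta :=
  ⟨(div_mul_cancel₀ I.maxSize h.ne').ge, fun _ hb => (div_le_iff₀ h).2 hb⟩

/-- The combined algorithm runs the first algorithm under this condition, and the second
algorithm otherwise. (If some capacity is `0`, which can happen in a repetition, no suitable `β`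
exists, and the second algorithm is run.) -/
def UsesSA1 (I : SPSC S V U) : Prop :=
  0 < I.minCap ∧ ¬ (1 ≤ I.beta ∨
    (1 - Real.exp (-1)) / 4 > 1 - Real.exp (-(1 - √I.beta) ^ 2))

/-- `X` is a possible output of the combined slot allocation algorithm. -/
def IsCSAOutput (I : SPSC S V U) (X : S → Finset V) : Prop :=
  (I.UsesSA1 ∧ I.IsSA1Output I.beta X) ∨ (¬ I.UsesSA1 ∧ I.IsSA2Output X)

/-- The approximation ratio as a function of `β`; the first algorithm and its exponential
expression only make sense for `β < 1`. -/
def approxRatio (β : ℝ) : ℝ :=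
  if β < 1 then max (1 - Real.exp (-(1 - √β) ^ 2)) ((1 - Real.exp (-1)) / 4)
  else (1 - Real.exp (-1)) / 4

/-- The variables of the repeated algorithm: remaining users, remaining capacities, and the
service placement built so far. -/
structure RSAState (S V U : Type*) where
  users : Finset U
  cap : V → ℝ
  placement : S → Finset V

def rsaInit (I : SPSC S V U) : RSAState S V U := ⟨I.users, I.cap, fun _ => ∅⟩

/-- One iteration of the loop of the repeated slot allocation algorithm. -/
def RSAStep (I : SPSC S V U) (s t : RSAState S V U) : Prop :=
  ∃ X, IsCSAOutput { I with users := s.users, cap := s.cap } X ∧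
    t.users = s.users.filter (fun k => X (I.service k) ∩ I.nodes k = ∅) ∧
    (∀ j, t.cap j = s.cap j - ∑ i ∈ Finset.univ.filter (fun i => j ∈ X i), I.size i) ∧
    (∀ i, t.placement i = s.placement i ∪ X i)

/-- `st 0, …, st (N + 1)` are the states of a complete run, with `N + 1` iterations, of the
repeated algorithm: the last iteration is the first one that leaves the placement unchanged.
The output is `(st (N + 1)).placement`. -/
def IsRSARun (I : SPSC S V U) (N : ℕ) (st : ℕ → RSAState S V U) : Prop :=
  st 0 = I.rsaInit ∧ (∀ n ≤ N, I.RSAStep (st n) (st (n + 1))) ∧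
    (∀ n < N, (st (n + 1)).placement ≠ (st n).placement) ∧
    (st (N + 1)).placement = (st N).placement

/-- `X` is a feasible placement whose reward is between `ρ` times the optimum and the optimum. -/
def IsApprox (I : SPSC S V U) (ρ : ℝ) (X : S → Finset V) : Prop :=
  I.Feasible X ∧ ρ * I.opt ≤ I.reward X ∧ I.reward X ≤ I.opt

end Algorithms

end SPSC

end

/-! SA1 and SA2 are randomized roundings of an LP optimum, derandomized by conditional expectations.
Let every slot draw independently a service of its class, `i` with probability `p i j / d`. Given a
partial filling, `expReward` is the resulting expected reward (classes of mass `0` contribute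
nothing). It is at most the average of its values after one more random draw, so a maximizing choice
never lowers it (`FillRun.expReward_le`). The modes of SA2 are treated likewise
(`ModeRun.expRewardMap_le`). It therefore suffices to bound the reward of the random experiment.

That bound is `LPOptimal.mul_opt_le`. Suppose service `i` misses node `j` with probability at most
`q ^ p i j`. By independence, user `k` stays unsatisfied with probability at most `q ^ ∑ p ≤ q ^ r k
≤ 1 - (1 - q) * r k`, and the LP value is at least `opt`; the ratio is `1 - q`.

For SA1, at least `ν d` slots for a class of mass `d` give a miss probability of at most `exp (-ν
p)`. Where `p > 0`, `ν ≥ δ`, so `q = exp (-δ)`. Rounding the numbers of slots up costs a geometric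
series, and `γ = 1 - √β` makes the total space at most `γ c + √β c = c` (`sum_levelSlots_le`).

For SA2, `LPFeasible.one_sub_placeProb_none_le` gives `q = 1 - (1 - e⁻¹) / 4`: a node serves large,
medium or small services, with mode probabilities that leave small services enough weight
(`le_weight_three`).

CSA takes the better applicable guarantee. RSA begins with a CSA run and afterwards only enlarges
the placement within the remaining capacities, which yields its ratio, its monotonicity and, by
finiteness, its termination. -/

set_option linter.unusedSectionVars false

noncomputable section

namespace SPSC

/-! ### Greedy filling of slots by conditional expectations. -/

section Filling

open scoped Classical

variable {S V U : Type*} [Fintype S] [Fintype V]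

theorem le_classMass (I : SPSC S V U) (β : ℝ) {p : S → V → ℝ} (hp : ∀ i j, 0 ≤ p i j) {i : S}
    {j : V} {l : SlotLabel} (hi : i ∈ I.sizeClass β j l) : p i j ≤ I.classMass β p j l :=
  Finset.single_le_sum (f := fun i => p i j) (fun i _ => hp i j) hi

theorem classMass_nonneg (I : SPSC S V U) (β : ℝ) {p : S → V → ℝ} (hp : ∀ i j, 0 ≤ p i j)
    (j : V) (l : SlotLabel) : 0 ≤ I.classMass β p j l :=
  Finset.sum_nonneg fun i _ => hp i j

theorem div_classMass_le_one (I : SPSC S V U) (β : ℝ) {p : S → V → ℝ} (hp : ∀ i j, 0 ≤ p i j)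
    {i : S} {j : V} {l : SlotLabel} (hi : i ∈ I.sizeClass β j l) :
    p i j / I.classMass β p j l ≤ 1 :=
  div_le_one_of_le₀ (I.le_classMass β hp hi) (I.classMass_nonneg β hp j l)

theorem satProb_le_one (I : SPSC S V U) (β : ℝ) {p : S → V → ℝ} (hp : ∀ i j, 0 ≤ p i j)
    (L : List (Slot V)) (τ : Slot V → Option S) (k : U) : I.satProb β p L τ k ≤ 1 := by
  unfold satProb
  split_ifs
  · exact le_rfl
  · refine sub_le_self _ (Finset.prod_nonneg fun σ hσ => ?_)
    exact sub_nonneg.2 (I.div_classMass_le_one β hp (Finset.mem_filter.1 hσ).2.2.2)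

theorem satProb_update_of_satisfied (I : SPSC S V U) (β : ℝ) (p : S → V → ℝ) {L : List (Slot V)}
    {τ : Slot V → Option S} {σ : Slot V} (hτ : τ σ = none) {k : U}
    (hk : ∃ ρ ∈ L, ρ.node ∈ I.nodes k ∧ τ ρ = some (I.service k)) (i : S) :
    I.satProb β p L (Function.update τ σ (some i)) k = 1 := by
  obtain ⟨ρ, hρ, hn, hs⟩ := hk
  have hne : ρ ≠ σ := by rintro rfl; simp [hτ] at hs
  exact if_pos ⟨ρ, hρ, hn, by rw [Function.update_of_ne hne, hs]⟩

/-- At worst `σ` is lost to user `k`: its factor leaves the product, and the other empty slots keep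
theirs. This bound does not depend on `i`. -/
theorem le_satProb_update (I : SPSC S V U) (β : ℝ) {p : S → V → ℝ} (hp : ∀ i j, 0 ≤ p i j)
    (L : List (Slot V)) (τ : Slot V → Option S) (σ : Slot V) (k : U) (i : S) :
    1 - ∏ ρ ∈ (L.toFinset.filter fun ρ => ρ.node ∈ I.nodes k ∧ τ ρ = none ∧
      I.service k ∈ I.sizeClass β ρ.node ρ.label).erase σ,
      (1 - p (I.service k) ρ.node / I.classMass β p ρ.node ρ.label) ≤
    I.satProb β p L (Function.update τ σ (some i)) k := by
  unfold satProb
  split_ifs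
  · refine sub_le_self _ (Finset.prod_nonneg fun ρ hρ => ?_)
    exact sub_nonneg.2
      (I.div_classMass_le_one β hp (Finset.mem_filter.1 (Finset.mem_of_mem_erase hρ)).2.2.2)
  · refine le_of_eq ?_
    congr 2
    ext ρ
    by_cases h : ρ = σ
    · subst h; simp
    · simp [h]

/-- Filling a slot with a random service of its class does not change the satisfaction
probabilities (only the inequality that is needed is stated). -/
theorem satProb_le_average (I : SPSC S V U) (β : ℝ) {p : S → V → ℝ} (hp : ∀ i j, 0 ≤ p i j)
    {L : List (Slot V)} {τ : Slot V → Option S} {σ : Slot V} (hσ : σ ∈ L) (hτ : τ σ = none)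
    (hd : 0 < I.classMass β p σ.node σ.label) (k : U) :
    I.satProb β p L τ k ≤ ∑ i ∈ I.sizeClass β σ.node σ.label,
      p i σ.node / I.classMass β p σ.node σ.label *
        I.satProb β p L (Function.update τ σ (some i)) k := by
  have hsum : ∑ i ∈ I.sizeClass β σ.node σ.label, p i σ.node / I.classMass β p σ.node σ.label
      = 1 := by
    rw [← Finset.sum_div]; exact div_self hd.ne'
  have hnn : ∀ i, 0 ≤ p i σ.node / I.classMass β p σ.node σ.label :=
    fun i => div_nonneg (hp _ _) hd.le
  by_cases hk : ∃ ρ ∈ L, ρ.node ∈ I.nodes k ∧ τ ρ = some (I.service k)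
  · simp_rw [I.satProb_update_of_satisfied β p hτ hk, mul_one, hsum]
    exact I.satProb_le_one β hp L τ k
  have h0 := fun i => I.le_satProb_update β hp L τ σ k i
  unfold satProb at ⊢
  rw [if_neg hk]
  simp only [← satProb.eq_1]
  set F := L.toFinset.filter fun ρ => ρ.node ∈ I.nodes k ∧ τ ρ = none ∧
      I.service k ∈ I.sizeClass β ρ.node ρ.label with hF
  set f := fun ρ : Slot V => 1 - p (I.service k) ρ.node / I.classMass β p ρ.node ρ.label with hf
  -- If `σ` can serve `k`, a draw does so with probability `x` and otherwise leaves the product `P`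
  -- over the other slots: `x + (1 - x) * (1 - P) = 1 - (1 - x) * P`. If not, erasing `σ` changes
  -- nothing.
  by_cases hmem : σ ∈ F
  · have hmem' := (Finset.mem_filter.1 hmem).2
    have hone : I.satProb β p L (Function.update τ σ (some (I.service k))) k = 1 :=
      if_pos ⟨σ, hσ, hmem'.1, by simp⟩
    rw [← Finset.mul_prod_erase F f hmem, ← Finset.add_sum_erase _ _ hmem'.2.2, hone]
    rw [← Finset.add_sum_erase _ _ hmem'.2.2] at hsum
    have : ∑ i ∈ (I.sizeClass β σ.node σ.label).erase (I.service k),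
        p i σ.node / I.classMass β p σ.node σ.label * (1 - ∏ ρ ∈ F.erase σ, f ρ) ≤
        ∑ i ∈ (I.sizeClass β σ.node σ.label).erase (I.service k),
        p i σ.node / I.classMass β p σ.node σ.label *
          I.satProb β p L (Function.update τ σ (some i)) k :=
      Finset.sum_le_sum fun i _ => mul_le_mul_of_nonneg_left (h0 i) (hnn i)
    rw [← Finset.sum_mul, eq_sub_of_add_eq' hsum] at this
    simp only [hf] at this ⊢
    linarith
  · have : ∑ i ∈ I.sizeClass β σ.node σ.label,
        p i σ.node / I.classMass β p σ.node σ.label * (1 - ∏ ρ ∈ F.erase σ, f ρ) ≤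
        ∑ i ∈ I.sizeClass β σ.node σ.label,
        p i σ.node / I.classMass β p σ.node σ.label *
          I.satProb β p L (Function.update τ σ (some i)) k :=
      Finset.sum_le_sum fun i _ => mul_le_mul_of_nonneg_left (h0 i) (hnn i)
    rwa [← Finset.sum_mul, hsum, one_mul, Finset.erase_eq_of_notMem hmem] at this

/-- There is no distribution to average over, but since `x / 0 = 0` the factor of `σ` is `1`, so
losing `σ` costs nothing. -/
theorem satProb_le_update_of_classMass_eq_zero (I : SPSC S V U) (β : ℝ) {p : S → V → ℝ}
    (hp : ∀ i j, 0 ≤ p i j) {L : List (Slot V)} {τ : Slot V → Option S} {σ : Slot V}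
    (hτ : τ σ = none) (hd : I.classMass β p σ.node σ.label = 0) (k : U) (i : S) :
    I.satProb β p L τ k ≤ I.satProb β p L (Function.update τ σ (some i)) k := by
  by_cases hk : ∃ ρ ∈ L, ρ.node ∈ I.nodes k ∧ τ ρ = some (I.service k)
  · rw [I.satProb_update_of_satisfied β p hτ hk]
    exact I.satProb_le_one β hp L τ k
  · refine le_trans (le_of_eq ?_) (I.le_satProb_update β hp L τ σ k i)
    unfold satProb
    rw [if_neg hk, Finset.prod_erase _ (by simp [hd])]

theorem exists_expReward_le_update (I : SPSC S V U) (β : ℝ) {p : S → V → ℝ}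
    (hw : ∀ k ∈ I.users, 0 ≤ I.weight k) (hp : ∀ i j, 0 ≤ p i j) {L : List (Slot V)}
    {τ : Slot V → Option S} {σ : Slot V} (hσ : σ ∈ L) (hτ : τ σ = none)
    (hne : (I.sizeClass β σ.node σ.label).Nonempty) :
    ∃ i ∈ I.sizeClass β σ.node σ.label,
      I.expReward β p L τ ≤ I.expReward β p L (Function.update τ σ (some i)) := by
  rcases (I.classMass_nonneg β hp σ.node σ.label).eq_or_lt with hd | hd
  · obtain ⟨i, hi⟩ := hne
    exact ⟨i, hi, Finset.sum_le_sum fun k hk => mul_le_mul_of_nonneg_right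
      (I.satProb_le_update_of_classMass_eq_zero β hp hτ hd.symm k i) (hw k hk)⟩
  · by_contra! hcon
    have h1 : I.expReward β p L τ ≤ ∑ i ∈ I.sizeClass β σ.node σ.label,
        p i σ.node / I.classMass β p σ.node σ.label *
          I.expReward β p L (Function.update τ σ (some i)) := by
      simp only [expReward, Finset.mul_sum]
      rw [Finset.sum_comm]
      refine Finset.sum_le_sum fun k hk => ?_
      simp only [← mul_assoc, ← Finset.sum_mul]
      exact mul_le_mul_of_nonneg_right (I.satProb_le_average β hp hσ hτ hd k) (hw k hk)
    -- A choice of positive probability makes the averaged inequality strict, which contradicts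
    -- `h1`.
    have hpos : ∃ i ∈ I.sizeClass β σ.node σ.label, 0 < p i σ.node := by
      by_contra! h
      exact hd.not_ge (Finset.sum_nonpos h)
    obtain ⟨i₀, hi₀, hpi₀⟩ := hpos
    have h2 : ∑ i ∈ I.sizeClass β σ.node σ.label,
        p i σ.node / I.classMass β p σ.node σ.label *
          I.expReward β p L (Function.update τ σ (some i)) <
        ∑ i ∈ I.sizeClass β σ.node σ.label,
        p i σ.node / I.classMass β p σ.node σ.label * I.expReward β p L τ :=
      Finset.sum_lt_sum
        (fun i hi => mul_le_mul_of_nonneg_left (hcon i hi).le (div_nonneg (hp _ _) hd.le))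
        ⟨i₀, hi₀, mul_lt_mul_of_pos_left (hcon i₀ hi₀) (div_pos hpi₀ hd)⟩
    rw [← Finset.sum_mul, ← Finset.sum_div] at h2
    have h3 : (∑ i ∈ I.sizeClass β σ.node σ.label, p i σ.node) /
      I.classMass β p σ.node σ.label = 1 := div_self hd.ne'
    rw [h3, one_mul] at h2
    exact absurd h1 h2.not_ge

theorem FillRun.expReward_le {I : SPSC S V U} {β : ℝ} {p : S → V → ℝ}
    (hw : ∀ k ∈ I.users, 0 ≤ I.weight k) (hp : ∀ i j, 0 ≤ p i j) {L todo : List (Slot V)}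
    {τ ψ : Slot V → Option S} (h : I.FillRun β p L todo τ ψ) (hnd : todo.Nodup)
    (hsub : ∀ σ ∈ todo, σ ∈ L) (hτ : ∀ σ ∈ todo, τ σ = none) :
    I.expReward β p L τ ≤ I.expReward β p L ψ := by
  induction h with
  | done τ => exact le_rfl
  | fill σ todo τ ψ i hi hmax hrest ih =>
    rw [List.nodup_cons] at hnd
    obtain ⟨i', hi', hle⟩ := I.exists_expReward_le_update β hw hp (hsub σ (by simp))
      (hτ σ (by simp)) ⟨i, hi⟩
    refine (hle.trans (hmax i' hi')).trans
      (ih hnd.2 (fun ρ hρ => hsub ρ (by simp [hρ])) fun ρ hρ => ?_)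
    rw [Function.update_of_ne (by rintro rfl; exact hnd.1 hρ), hτ ρ (by simp [hρ])]
  | skip σ todo τ ψ hempty hrest ih =>
    rw [List.nodup_cons] at hnd
    exact ih hnd.2 (fun ρ hρ => hsub ρ (by simp [hρ])) fun ρ hρ => hτ ρ (by simp [hρ])

theorem FillRun.eq_of_notMem {I : SPSC S V U} {β : ℝ} {p : S → V → ℝ} {L todo : List (Slot V)}
    {τ ψ : Slot V → Option S} (h : I.FillRun β p L todo τ ψ) {σ : Slot V} (hσ : σ ∉ todo) :
    ψ σ = τ σ := by
  induction h with
  | done τ => rfl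
  | fill ρ todo τ ψ i hi hmax hrest ih =>
    simp only [List.mem_cons, not_or] at hσ
    rw [ih hσ.2, Function.update_of_ne hσ.1]
  | skip ρ todo τ ψ hempty hrest ih =>
    simp only [List.mem_cons, not_or] at hσ
    exact ih hσ.2

theorem FillRun.mem_sizeClass {I : SPSC S V U} {β : ℝ} {p : S → V → ℝ}
    {L todo : List (Slot V)} {τ ψ : Slot V → Option S} (h : I.FillRun β p L todo τ ψ)
    (hnd : todo.Nodup) (hτ : ∀ σ ∈ todo, τ σ = none) {σ : Slot V} (hσ : σ ∈ todo) :
    (∃ i ∈ I.sizeClass β σ.node σ.label, ψ σ = some i) ∨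
      (ψ σ = none ∧ I.sizeClass β σ.node σ.label = ∅) := by
  induction h with
  | done τ => simp at hσ
  | fill ρ todo τ ψ i hi hmax hrest ih =>
    rw [List.nodup_cons] at hnd
    rcases List.mem_cons.1 hσ with rfl | hσ
    · exact .inl ⟨i, hi, by rw [hrest.eq_of_notMem hnd.1, Function.update_self]⟩
    · refine ih hnd.2 (fun ρ' hρ' => ?_) hσ
      rw [Function.update_of_ne (by rintro rfl; exact hnd.1 hρ'), hτ ρ' (by simp [hρ'])]
  | skip ρ todo τ ψ hempty hrest ih =>
    rw [List.nodup_cons] at hnd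
    rcases List.mem_cons.1 hσ with rfl | hσ
    · exact .inr ⟨by rw [hrest.eq_of_notMem hnd.1, hτ _ (by simp)], hempty⟩
    · exact ih hnd.2 (fun ρ' hρ' => hτ ρ' (by simp [hρ'])) hσ

theorem exists_fillRun (I : SPSC S V U) (β : ℝ) (p : S → V → ℝ) (L todo : List (Slot V))
    (τ : Slot V → Option S) : ∃ ψ, I.FillRun β p L todo τ ψ := by
  induction todo generalizing τ with
  | nil => exact ⟨τ, .done τ⟩
  | cons σ todo ih =>
    rcases (I.sizeClass β σ.node σ.label).eq_empty_or_nonempty with h | h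
    · obtain ⟨ψ, hψ⟩ := ih τ
      exact ⟨ψ, .skip σ todo τ ψ h hψ⟩
    · obtain ⟨i, hi, hmax⟩ := Finset.exists_max_image _
        (fun i => I.expReward β p L (Function.update τ σ (some i))) h
      obtain ⟨ψ, hψ⟩ := ih (Function.update τ σ (some i))
      exact ⟨ψ, .fill σ todo τ ψ i hi hmax hψ⟩

theorem exists_isFillOutput (I : SPSC S V U) (β : ℝ) (p : S → V → ℝ) {Λ : Set (Slot V)}
    (hΛ : Λ.Finite) : ∃ X, I.IsFillOutput β p Λ X := by
  obtain ⟨ψ, hψ⟩ := I.exists_fillRun β p hΛ.toFinset.toList hΛ.toFinset.toList fun _ => none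
  exact ⟨_, hΛ.toFinset.toList, ψ, Finset.nodup_toList _, by simp, hψ, rfl⟩

/-- The guarantees of greedy filling: the reward is at least the expected reward of filling the
slots at random, and the space used on a node is at most the total size of its slots. -/
theorem IsFillOutput.exists_finset {I : SPSC S V U} {β : ℝ} {p : S → V → ℝ} {Λ : Set (Slot V)}
    {X : S → Finset V} (h : I.IsFillOutput β p Λ X) (hs : ∀ i, 0 < I.size i)
    (hw : ∀ k ∈ I.users, 0 ≤ I.weight k) (hp : ∀ i j, 0 ≤ p i j) :
    ∃ F : Finset (Slot V), (∀ σ, σ ∈ F ↔ σ ∈ Λ) ∧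
      ∑ k ∈ I.users, (1 - ∏ σ ∈ F.filter fun σ => σ.node ∈ I.nodes k ∧
        I.service k ∈ I.sizeClass β σ.node σ.label,
        (1 - p (I.service k) σ.node / I.classMass β p σ.node σ.label)) * I.weight k ≤
        I.reward X ∧
      ∀ (j : V) (B : Slot V → ℝ), (∀ σ ∈ F, 0 ≤ B σ) →
        (∀ σ ∈ F, ∀ i ∈ I.sizeClass β σ.node σ.label, I.size i ≤ B σ) →
        ∑ i, (if j ∈ X i then I.size i else 0) ≤ ∑ σ ∈ F.filter fun σ => σ.node = j, B σ := by
  obtain ⟨L, ψ, hnd, hL, hrun, rfl⟩ := h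
  have hcls := fun σ (hσ : σ ∈ L) => hrun.mem_sizeClass hnd (fun _ _ => rfl) hσ
  refine ⟨L.toFinset, by simpa using hL, ?_, fun j B hB0 hB => ?_⟩
  · have h1 := hrun.expReward_le hw hp hnd (fun _ h => h) fun _ _ => rfl
    refine le_trans (le_of_eq ?_) (h1.trans ?_)
    · simp [expReward, satProb]
    · refine Finset.sum_le_sum fun k hk => ?_
      have hiff : I.Satisfied (placementOf L ψ) k ↔
          ∃ σ ∈ L, σ.node ∈ I.nodes k ∧ ψ σ = some (I.service k) := by
        simp only [Satisfied, placementOf, Finset.Nonempty, Finset.mem_inter, Finset.mem_filter,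
          Finset.mem_univ, true_and]
        constructor
        · rintro ⟨j, hj, σ, hσ, rfl, h⟩; exact ⟨σ, hσ, hj, h⟩
        · rintro ⟨σ, hσ, hj, h⟩; exact ⟨_, hj, σ, hσ, rfl, h⟩
      unfold satProb
      by_cases hsat : I.Satisfied (placementOf L ψ) k
      · rw [if_pos hsat, if_pos (hiff.1 hsat), one_mul]
      -- After the run only slots with an empty class are empty, so the product is empty and the
      -- value is `0`: `satProb` has become the indicator of satisfaction.
      · rw [if_neg hsat, if_neg (mt hiff.2 hsat), Finset.filter_eq_empty_iff.2, Finset.prod_empty, sub_self, zero_mul]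
        rintro σ hσ ⟨-, hnone, hmem⟩
        rcases hcls σ (by simpa using hσ) with ⟨i, -, hi⟩ | ⟨-, he⟩
        · simp [hnone] at hi
        · simp [he] at hmem
  -- Each service on `j` is charged to a slot that holds it; a slot holds at most one service.
  · have hsz : ∀ i, (if j ∈ placementOf L ψ i then I.size i else 0) ≤
        ∑ σ ∈ L.toFinset.filter (fun σ => σ.node = j), if ψ σ = some i then I.size i else 0 := by
      intro i
      split_ifs with hj
      · simp only [placementOf, Finset.mem_filter, Finset.mem_univ, true_and] at hj
        obtain ⟨σ, hσ, hn, hψ⟩ := hj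
        refine le_trans (by simp [hψ]) (Finset.single_le_sum (f := fun σ =>
          if ψ σ = some i then I.size i else 0) (fun ρ _ => ?_)
          (Finset.mem_filter.2 ⟨List.mem_toFinset.2 hσ, hn⟩))
        split_ifs
        exacts [(hs i).le, le_rfl]
      · refine Finset.sum_nonneg fun ρ _ => ?_
        split_ifs
        exacts [(hs i).le, le_rfl]
    refine (Finset.sum_le_sum fun i _ => hsz i).trans ?_
    rw [Finset.sum_comm]
    refine Finset.sum_le_sum fun σ hσ => ?_
    have hσL : σ ∈ L.toFinset := (Finset.mem_filter.1 hσ).1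
    rcases hcls σ (by simpa using hσL) with ⟨i, hi, hψ⟩ | ⟨hψ, -⟩
    · simpa [hψ] using hB σ hσL i hi
    · simpa [hψ] using hB0 σ hσL

end Filling

/-! ### Size levels: uniqueness, space consumption, products over slots. -/

section Levels

open scoped Classical

variable {S V U : Type*} [Fintype S] [Fintype V]

theorem sqrt_mem_Ioo {β : ℝ} (h0 : 0 < β) (h1 : β < 1) : 0 < √β ∧ √β < 1 :=
  ⟨Real.sqrt_pos.2 h0, by rw [Real.sqrt_lt' one_pos]; simpa using h1⟩

theorem gamma_pos {β : ℝ} (h0 : 0 < β) (h1 : β < 1) : 0 < gamma β :=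
  sub_pos.2 (sqrt_mem_Ioo h0 h1).2

theorem gamma_lt_one {β : ℝ} (h0 : 0 < β) : gamma β < 1 :=
  sub_lt_self _ (Real.sqrt_pos.2 h0)

theorem delta_eq (β : ℝ) : delta β = gamma β ^ 2 := rfl

theorem cap_pos_of_mem_level (I : SPSC S V U) {β : ℝ} (h0 : 0 < β) (h1 : β < 1) {i : S}
    (hs : 0 < I.size i) {j : V} {q : ℕ} (hq : i ∈ I.sizeClass β j (.level q)) : 0 < I.cap j := by
  have h := (Finset.mem_filter.1 hq).2.2.2
  have hγ := pow_pos (gamma_pos h0 h1) (q - 1)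
  by_contra! hc
  have : gamma β ^ (q - 1) * I.cap j * β ≤ 0 :=
    mul_nonpos_of_nonpos_of_nonneg (mul_nonpos_of_nonneg_of_nonpos hγ.le hc) h0.le
  linarith

theorem level_unique (I : SPSC S V U) {β : ℝ} (h0 : 0 < β) (h1 : β < 1) {i : S}
    (hs : 0 < I.size i) {j : V} {q q' : ℕ} (hq : i ∈ I.sizeClass β j (.level q))
    (hq' : i ∈ I.sizeClass β j (.level q')) : q = q' := by
  have key : ∀ a b : ℕ, i ∈ I.sizeClass β j (.level a) → i ∈ I.sizeClass β j (.level b) →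
      ¬ a < b := by
    intro a b ha hb hab
    have hc := I.cap_pos_of_mem_level h0 h1 hs ha
    have ha' := (Finset.mem_filter.1 ha).2.2.1
    have hb' := (Finset.mem_filter.1 hb).2.2.2
    have : gamma β ^ (b - 1) ≤ gamma β ^ a :=
      pow_le_pow_of_le_one (gamma_pos h0 h1).le (gamma_lt_one h0).le (by omega)
    have := mul_le_mul_of_nonneg_right (mul_le_mul_of_nonneg_right this hc.le) h0.le
    linarith
  have := key _ _ hq hq'
  have := key _ _ hq' hq
  omega

theorem exists_level (I : SPSC S V U) {β : ℝ} (h0 : 0 < β) (h1 : β < 1) {i : S}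
    (hs : 0 < I.size i) {j : V} (hle : I.size i ≤ I.cap j * β) :
    ∃ q, i ∈ I.sizeClass β j (.level q) := by
  have hcβ : 0 < I.cap j * β := hs.trans_le hle
  obtain ⟨n, hn, hn'⟩ := exists_nat_pow_near_of_lt_one (div_pos hs hcβ)
    (div_le_one_of_le₀ hle hcβ.le) (gamma_pos h0 h1) (gamma_lt_one h0)
  rw [lt_div_iff₀ hcβ] at hn
  rw [div_le_iff₀ hcβ] at hn'
  -- The exponent satisfies `γ ^ (n + 1) < s / (c * β) ≤ γ ^ n`; levels are numbered from `1`.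
  refine ⟨n + 1, Finset.mem_filter.2 ⟨Finset.mem_univ _, by omega, ?_, ?_⟩⟩
  · rwa [mul_assoc]
  · rwa [Nat.add_sub_cancel, mul_assoc]

theorem size_le_of_mem_level (I : SPSC S V U) {β : ℝ} (h0 : 0 < β) (h1 : β < 1) {i : S}
    (hs : 0 < I.size i) {j : V} {q : ℕ} (hq : i ∈ I.sizeClass β j (.level q)) :
    I.size i ≤ I.cap j * β := by
  have hc := I.cap_pos_of_mem_level h0 h1 hs hq
  refine ((Finset.mem_filter.1 hq).2.2.2).trans ?_
  have := pow_le_one₀ (n := q - 1) (gamma_pos h0 h1).le (gamma_lt_one h0).le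
  have := mul_le_mul_of_nonneg_right this (mul_pos hc h0).le
  linarith

theorem finite_levels (I : SPSC S V U) {β : ℝ} (h0 : 0 < β) (h1 : β < 1)
    (hs : ∀ i, 0 < I.size i) (j : V) :
    {q | (I.sizeClass β j (.level q)).Nonempty}.Finite := by
  refine (Set.finite_iUnion fun i => Set.Subsingleton.finite
    (s := {q | i ∈ I.sizeClass β j (.level q)})
    fun q hq q' hq' => I.level_unique h0 h1 (hs i) hq hq').subset ?_
  rintro q ⟨i, hi⟩
  exact Set.mem_iUnion.2 ⟨i, hi⟩

/-- The number of slots of a level, if the normalizing sum runs over the services in `F`. -/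
def levelSlots (I : SPSC S V U) (β : ℝ) (p : S → V → ℝ) (F : Finset S) (j : V) (q : ℕ) : ℕ :=
  ⌈delta β * I.cap j / (∑ i ∈ F, I.size i * p i j) * I.classMass β p j (.level q)⌉₊

/-- A class has fewer than `ν d + 1` slots. Sizes within a class differ by a factor of at most `1 /
γ`, so the parts `ν d` need at most `ν / γ` times the normalizing sum, that is `(δ / γ) c = γ c`.
The extra slots, one per level, need at most `c β / (1 - γ) = √β c`. -/
theorem sum_levelSlots_le (I : SPSC S V U) {β : ℝ} (h0 : 0 < β) (h1 : β < 1)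
    (hs : ∀ i, 0 < I.size i) {p : S → V → ℝ} (hp : ∀ i j, 0 ≤ p i j) {j : V}
    (hc : 0 ≤ I.cap j) {F : Finset S} (hF : ∀ q, I.sizeClass β j (.level q) ⊆ F)
    {Q : Finset ℕ} (hQ : ∀ q ∈ Q, 1 ≤ q) :
    ∑ q ∈ Q, (I.levelSlots β p F j q : ℝ) * (gamma β ^ (q - 1) * I.cap j * β) ≤ I.cap j := by
  have hγ := gamma_pos h0 h1
  have hγ1 := gamma_lt_one h0
  set c := I.cap j with hcdef
  set A := ∑ i ∈ F, I.size i * p i j with hA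
  have hA0 : 0 ≤ A := Finset.sum_nonneg fun i _ => mul_nonneg (hs i).le (hp i j)
  set ν := delta β * c / A with hν
  have hδ : 0 ≤ delta β := sq_nonneg _
  have hν0 : 0 ≤ ν := div_nonneg (mul_nonneg hδ hc) hA0
  have hcβ : 0 ≤ c * β := mul_nonneg hc h0.le
  have hmass : ∀ q ∈ Q, I.classMass β p j (.level q) * (gamma β ^ q * c * β) ≤
      ∑ i ∈ I.sizeClass β j (.level q), I.size i * p i j := by
    intro q _
    rw [classMass, Finset.sum_mul]
    refine Finset.sum_le_sum fun i hi => ?_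
    rw [mul_comm]
    exact mul_le_mul_of_nonneg_right (Finset.mem_filter.1 hi).2.2.1.le (hp i j)
  have hdisj : ∑ q ∈ Q, ∑ i ∈ I.sizeClass β j (.level q), I.size i * p i j ≤ A := by
    rw [← Finset.sum_biUnion]
    · exact Finset.sum_le_sum_of_subset_of_nonneg
        (Finset.biUnion_subset.2 fun q _ => hF q) fun i _ _ => mul_nonneg (hs i).le (hp i j)
    · intro q _ q' _ hne
      exact Finset.disjoint_left.2 fun i hi hi' => hne (I.level_unique h0 h1 (hs i) hi hi')
  have hgeom : ∑ q ∈ Q, gamma β ^ (q - 1) ≤ (1 - gamma β)⁻¹ := by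
    rw [← tsum_geometric_of_lt_one hγ.le hγ1,
      ← Finset.sum_image (s := Q) (g := fun q => q - 1) (f := fun n => gamma β ^ n)]
    · exact (summable_geometric_of_lt_one hγ.le hγ1).sum_le_tsum _ fun n _ => pow_nonneg hγ.le n
    · intro a ha b hb hab
      have := hQ a ha
      have := hQ b hb
      simp only at hab
      omega
  have hterm : ∀ q ∈ Q, (I.levelSlots β p F j q : ℝ) * (gamma β ^ (q - 1) * c * β) ≤
      ν / gamma β * ∑ i ∈ I.sizeClass β j (.level q), I.size i * p i j +
        c * β * gamma β ^ (q - 1) := by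
    intro q hq
    have hn : (I.levelSlots β p F j q : ℝ) ≤ ν * I.classMass β p j (.level q) + 1 :=
      (Nat.ceil_lt_add_one (mul_nonneg hν0 (I.classMass_nonneg β hp _ _))).le
    have hB : 0 ≤ gamma β ^ (q - 1) * c * β := by positivity
    refine (mul_le_mul_of_nonneg_right hn hB).trans ?_
    have h2 := mul_le_mul_of_nonneg_left (hmass q hq) (div_nonneg hν0 hγ.le)
    have h3 : ν / gamma β * (I.classMass β p j (.level q) * (gamma β ^ q * c * β)) =
        ν * I.classMass β p j (.level q) * (gamma β ^ (q - 1) * c * β) := by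
      obtain ⟨m, rfl⟩ : ∃ m, q = m + 1 := ⟨q - 1, by have := hQ q hq; omega⟩
      rw [Nat.add_sub_cancel, pow_succ]
      field_simp
    linarith
  refine (Finset.sum_le_sum hterm).trans ?_
  rw [Finset.sum_add_distrib, ← Finset.mul_sum, ← Finset.mul_sum]
  have e1 := mul_le_mul_of_nonneg_left hdisj (div_nonneg hν0 hγ.le)
  have e2 := mul_le_mul_of_nonneg_left hgeom hcβ
  -- For `A > 0` this is an equality because `δ = γ ^ 2`; for `A = 0` the left side vanishes.
  have e3 : ν / gamma β * A ≤ gamma β * c := by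
    rcases hA0.eq_or_lt with h | h
    · rw [← h, mul_zero]; positivity
    · rw [hν, delta_eq]
      refine le_of_eq ?_
      field_simp
  have e4 : c * β * (1 - gamma β)⁻¹ = √β * c := by
    have hβ := (sqrt_mem_Ioo h0 h1).1
    have : 1 - gamma β = √β := by simp [gamma]
    rw [this]
    nth_rewrite 1 [← Real.mul_self_sqrt h0.le]
    field_simp
  have e5 : gamma β * c + √β * c = c := by simp only [gamma]; ring
  linarith

/-- An upper bound for the sizes of the services that may occupy a slot. -/
def slotSize (I : SPSC S V U) (β : ℝ) (σ : Slot V) : ℝ :=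
  match σ.label with
  | .level q => gamma β ^ (q - 1) * I.cap σ.node * β
  | .plus => I.cap σ.node
  | .minus => 1 / 2 * I.cap σ.node

theorem size_le_slotSize (I : SPSC S V U) {β : ℝ} {σ : Slot V} {i : S}
    (hi : i ∈ I.sizeClass β σ.node σ.label) : I.size i ≤ I.slotSize β σ := by
  obtain ⟨j, l, t⟩ := σ
  cases l with
  | level q => exact (Finset.mem_filter.1 hi).2.2.2
  | plus => exact (Finset.mem_filter.1 hi).2.2
  | minus => exact (Finset.mem_filter.1 hi).2.2

theorem slotSize_nonneg (I : SPSC S V U) {β : ℝ} (h0 : 0 < β) (h1 : β < 1)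
    (hc : ∀ j, 0 ≤ I.cap j) (σ : Slot V) : 0 ≤ I.slotSize β σ := by
  have hγ := (gamma_pos h0 h1).le
  obtain ⟨j, l, t⟩ := σ
  have := hc j
  cases l <;> simp only [slotSize] <;> positivity

theorem sum_slotSize_le (I : SPSC S V U) {β : ℝ} (h0 : 0 < β) (h1 : β < 1)
    (hs : ∀ i, 0 < I.size i) {p : S → V → ℝ} (hp : ∀ i j, 0 ≤ p i j) {j : V}
    (hc : ∀ j, 0 ≤ I.cap j) {F : Finset S} (hF : ∀ q, I.sizeClass β j (.level q) ⊆ F)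
    {G : Finset (Slot V)} (hG : ∀ σ ∈ G, σ.node = j ∧ ∃ q, 1 ≤ q ∧ σ.label = .level q ∧
      (I.sizeClass β j (.level q)).Nonempty ∧ σ.idx < I.levelSlots β p F j q) :
    ∑ σ ∈ G, I.slotSize β σ ≤ I.cap j := by
  set Q := (I.finite_levels h0 h1 hs j).toFinset with hQ
  have hsub : G ⊆ (Q.sigma fun q => Finset.range (I.levelSlots β p F j q)).image
      fun x => ⟨j, .level x.1, x.2⟩ := by
    intro σ hσ
    obtain ⟨hj, q, -, hl, hne, hlt⟩ := hG σ hσ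
    refine Finset.mem_image.2 ⟨⟨q, σ.idx⟩, ?_, ?_⟩
    · simpa [hQ, hlt] using hne
    · cases σ; simp_all
  refine (Finset.sum_le_sum_of_subset_of_nonneg hsub
    fun σ _ _ => I.slotSize_nonneg h0 h1 hc σ).trans ?_
  rw [Finset.sum_image, Finset.sum_sigma]
  · refine le_trans (le_of_eq ?_) (I.sum_levelSlots_le h0 h1 hs hp (hc j) hF (Q := Q) ?_)
    · simp [slotSize]
    · intro q hq
      obtain ⟨i, hi⟩ : (I.sizeClass β j (.level q)).Nonempty := by simpa [hQ] using hq
      exact (Finset.mem_filter.1 hi).2.1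
  · rintro ⟨q, t⟩ - ⟨q', t'⟩ - h
    simp only [Slot.mk.injEq, SlotLabel.level.injEq, true_and] at h
    obtain ⟨rfl, rfl⟩ := h
    rfl

/-- Since `1 - x / d ≤ exp (-(x / d))` and the exponent is at least `ν * d`, the class mass cancels.
If `d = 0`, then `x = 0` and both sides are `1`. -/
theorem one_sub_div_pow_ceil_le {x d ν : ℝ} (hx : 0 ≤ x) (hxd : x ≤ d) :
    (1 - x / d) ^ ⌈ν * d⌉₊ ≤ Real.exp (-(ν * x)) := by
  rcases (hx.trans hxd).eq_or_lt with hd | hd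
  · have : x = 0 := le_antisymm (hxd.trans hd.ge) hx
    simp [this, ← hd]
  · have h1 : 1 - x / d ≤ Real.exp (-(x / d)) := Real.one_sub_le_exp_neg _
    have h2 : 0 ≤ 1 - x / d := sub_nonneg.2 (div_le_one_of_le₀ hxd hd.le)
    refine (pow_le_pow_left₀ h2 h1 _).trans ?_
    rw [← Real.exp_nat_mul, Real.exp_le_exp]
    have h3 := mul_le_mul_of_nonneg_right (Nat.le_ceil (ν * d)) (div_nonneg hx hd.le)
    have h4 : ν * d * (x / d) = ν * x := by field_simp
    linarith

/-- A product over slots is a product over nodes. -/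
theorem prod_slots_eq (G : Finset (Slot V)) (T : Finset V) (P : Slot V → Prop)
    [DecidablePred P] (f : Slot V → ℝ) :
    ∏ σ ∈ G.filter (fun σ => σ.node ∈ T ∧ P σ), f σ =
      ∏ j ∈ T, ∏ σ ∈ G.filter (fun σ => σ.node = j ∧ P σ), f σ := by
  rw [← Finset.prod_fiberwise_of_maps_to (t := T) (g := Slot.node)
    fun σ hσ => (Finset.mem_filter.1 hσ).2.1]
  refine Finset.prod_congr rfl fun j hj => ?_
  congr 1
  ext σ
  simp only [Finset.mem_filter]
  constructor
  · rintro ⟨⟨h1, -, h3⟩, h4⟩; exact ⟨h1, h4, h3⟩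
  · rintro ⟨h1, rfl, h3⟩; exact ⟨⟨h1, hj, h3⟩, rfl⟩

theorem prod_slots_eq_pow {G : Finset (Slot V)} {j : V} {l : SlotLabel} {n : ℕ}
    (hG : ∀ σ, σ ∈ G ↔ σ.node = j ∧ σ.label = l ∧ σ.idx < n) (f : V → SlotLabel → ℝ) :
    ∏ σ ∈ G, f σ.node σ.label = f j l ^ n := by
  have : G = (Finset.range n).image fun t => ⟨j, l, t⟩ := by
    ext ⟨a, b, t⟩
    simp only [hG, Finset.mem_image, Finset.mem_range, Slot.mk.injEq]
    constructor
    · rintro ⟨rfl, rfl, h⟩; exact ⟨t, h, rfl, rfl, rfl⟩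
    · rintro ⟨t, h, rfl, rfl, rfl⟩; exact ⟨rfl, rfl, h⟩
  rw [this, Finset.prod_image]
  · simp
  · intro a _ b _ h
    simpa using h

end Levels

/-! ### The LP relaxation. -/

section LinearProgram

open scoped Classical

variable {S V U : Type*} [Fintype S] [Fintype V]

theorem LPFeasible.indicator {I : SPSC S V U} (hs : ∀ i, 0 < I.size i) {X : S → Finset V}
    (hX : I.Feasible X) : I.LPFeasible (fun i j => if j ∈ X i then 1 else 0)
      (fun k => if I.Satisfied X k then 1 else 0) where
  r_nonneg k _ := by split_ifs <;> norm_num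
  r_le_one k _ := by split_ifs <;> norm_num
  p_nonneg i j := by split_ifs <;> norm_num
  p_le_one i j := by split_ifs <;> norm_num
  r_le_sum k _ := by
    have hnn : ∀ j ∈ I.nodes k, (0 : ℝ) ≤ if j ∈ X (I.service k) then 1 else 0 := by
      intro j _; split_ifs <;> norm_num
    split_ifs with h
    · obtain ⟨j, hj⟩ := h
      rw [Finset.mem_inter] at hj
      exact le_trans (by simp [hj.2]) (Finset.single_le_sum hnn hj.1)
    · exact Finset.sum_nonneg hnn
  cap_le j := by simpa [ite_mul] using hX j
  too_large i j h := by
    refine if_neg fun hj => h.not_ge ((hX j).trans' ?_)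
    refine le_trans (by simp [hj]) (Finset.single_le_sum (f := fun i =>
      if j ∈ X i then I.size i else 0) (fun i' _ => ?_) (Finset.mem_univ i))
    split_ifs
    exacts [(hs i').le, le_rfl]

theorem LPOptimal.opt_le {I : SPSC S V U} (hs : ∀ i, 0 < I.size i) (hc : ∀ j, 0 ≤ I.cap j)
    {p : S → V → ℝ} {r : U → ℝ} (h : I.LPOptimal p r) :
    I.opt ≤ ∑ k ∈ I.users, r k * I.weight k := by
  obtain ⟨X, hX, hXr⟩ := (I.isGreatest_opt hc).1
  rw [← hXr]
  simpa [reward, ite_mul] using h.2 _ _ (LPFeasible.indicator hs hX)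

/-- Compactness. The LP does not constrain `r` outside `users`, so the search is confined to a box,
and competitors are set to `0` there without changing their value. -/
theorem exists_isLPSolution (I : SPSC S V U) (hc : ∀ j, 0 ≤ I.cap j) :
    ∃ p, I.IsLPSolution p := by
  set K : Set ((S → V → ℝ) × (U → ℝ)) :=
    ((Set.univ.pi fun _ => Set.univ.pi fun _ => Set.Icc 0 1) ×ˢ
      (Set.univ.pi fun _ => Set.Icc 0 1)) ∩ {x | I.LPFeasible x.1 x.2} with hK
  have hclosed : IsClosed {x : (S → V → ℝ) × (U → ℝ) | I.LPFeasible x.1 x.2} := by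
    have : {x : (S → V → ℝ) × (U → ℝ) | I.LPFeasible x.1 x.2} =
        {x | (∀ k ∈ I.users, 0 ≤ x.2 k) ∧
          (∀ k ∈ I.users, x.2 k ≤ ∑ j ∈ I.nodes k, x.1 (I.service k) j) ∧
          (∀ k ∈ I.users, x.2 k ≤ 1) ∧ (∀ j, ∑ i, x.1 i j * I.size i ≤ I.cap j) ∧
          (∀ i j, I.cap j < I.size i → x.1 i j = 0) ∧ (∀ i j, 0 ≤ x.1 i j) ∧
          ∀ i j, x.1 i j ≤ 1} := by
      ext x
      exact ⟨fun ⟨a, b, c, d, e, f, g⟩ => ⟨a, b, c, d, e, f, g⟩,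
        fun ⟨a, b, c, d, e, f, g⟩ => ⟨a, b, c, d, e, f, g⟩⟩
    rw [this]
    simp only [Set.ofPred_and, Set.ofPred_forall]
    have hcp : ∀ i j, Continuous fun x : (S → V → ℝ) × (U → ℝ) => x.1 i j := by fun_prop
    have hcr : ∀ k, Continuous fun x : (S → V → ℝ) × (U → ℝ) => x.2 k := by fun_prop
    refine IsClosed.inter ?_ (IsClosed.inter ?_ (IsClosed.inter ?_ (IsClosed.inter ?_
      (IsClosed.inter ?_ (IsClosed.inter ?_ ?_)))))
    · exact isClosed_biInter fun k _ => isClosed_le continuous_const (hcr k)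
    · exact isClosed_biInter fun k _ => isClosed_le (hcr k)
        (continuous_finsetSum _ fun j _ => hcp _ j)
    · exact isClosed_biInter fun k _ => isClosed_le (hcr k) continuous_const
    · exact isClosed_iInter fun j => isClosed_le
        (continuous_finsetSum _ fun i _ => (hcp i j).mul continuous_const) continuous_const
    · exact isClosed_iInter fun i => isClosed_iInter fun j => isClosed_iInter fun _ =>
        isClosed_eq (hcp i j) continuous_const
    · exact isClosed_iInter fun i => isClosed_iInter fun j =>
        isClosed_le continuous_const (hcp i j)
    · exact isClosed_iInter fun i => isClosed_iInter fun j =>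
        isClosed_le (hcp i j) continuous_const
  have hcompact : IsCompact K := by
    refine IsCompact.inter_right (IsCompact.prod ?_ ?_) hclosed
    · exact isCompact_univ_pi fun _ => isCompact_univ_pi fun _ => isCompact_Icc
    · exact isCompact_univ_pi fun _ => isCompact_Icc
  have hne : K.Nonempty := by
    refine ⟨(fun _ _ => 0, fun _ => 0), ⟨?_, ?_⟩, ?_⟩
    · exact fun i _ j _ => ⟨le_rfl, zero_le_one⟩
    · exact fun k _ => ⟨le_rfl, zero_le_one⟩
    · constructor <;> simp [hc]
  obtain ⟨⟨p, r⟩, hpr, hmax⟩ := hcompact.exists_isMaxOn hne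
    (f := fun x => ∑ k ∈ I.users, x.2 k * I.weight k) (Continuous.continuousOn (by fun_prop))
  refine ⟨p, r, hpr.2, fun p' r' h' => ?_⟩
  have hmem : (p', fun k => if k ∈ I.users then r' k else 0) ∈ K := by
    refine ⟨⟨fun i _ j _ => ⟨h'.p_nonneg i j, h'.p_le_one i j⟩, fun k _ => ?_⟩, ?_⟩
    · by_cases hk : k ∈ I.users
      · simpa [hk] using And.intro (h'.r_nonneg k hk) (h'.r_le_one k hk)
      · simp [hk]
    · exact ⟨fun k hk => by simpa [hk] using h'.r_nonneg k hk,
        fun k hk => by simpa [hk] using h'.r_le_sum k hk,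
        fun k hk => by simpa [hk] using h'.r_le_one k hk,
        h'.cap_le, h'.too_large, h'.p_nonneg, h'.p_le_one⟩
  refine le_trans (le_of_eq ?_) (hmax hmem)
  exact Finset.sum_congr rfl fun k hk => by simp [hk]

/-- A bound on the expected reward, from bounds on the factors. -/
theorem LPOptimal.mul_opt_le {I : SPSC S V U} (hs : ∀ i, 0 < I.size i) (hc : ∀ j, 0 ≤ I.cap j)
    (hw : ∀ k ∈ I.users, 0 ≤ I.weight k) {p : S → V → ℝ} {r : U → ℝ} (h : I.LPOptimal p r)
    {q : ℝ} (hq0 : 0 < q) (hq1 : q ≤ 1) {a : S → V → ℝ} (ha0 : ∀ i j, 0 ≤ a i j)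
    (ha : ∀ i j, a i j ≤ q ^ p i j) :
    (1 - q) * I.opt ≤ ∑ k ∈ I.users, (1 - ∏ j ∈ I.nodes k, a (I.service k) j) * I.weight k := by
  refine (mul_le_mul_of_nonneg_left (h.opt_le hs hc) (sub_nonneg.2 hq1)).trans ?_
  rw [Finset.mul_sum]
  refine Finset.sum_le_sum fun k hk => ?_
  rw [← mul_assoc]
  refine mul_le_mul_of_nonneg_right ?_ (hw k hk)
  have h1 : ∏ j ∈ I.nodes k, a (I.service k) j ≤ q ^ ∑ j ∈ I.nodes k, p (I.service k) j := by
    rw [Real.rpow_sum_of_pos hq0]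
    exact Finset.prod_le_prod (fun j _ => ha0 _ j) fun j _ => ha _ j
  have h2 : q ^ ∑ j ∈ I.nodes k, p (I.service k) j ≤ q ^ r k :=
    Real.rpow_le_rpow_of_exponent_ge hq0 hq1 (h.1.r_le_sum k hk)
  -- Bernoulli's inequality for exponents in `[0, 1]`: `q ^ r ≤ 1 - (1 - q) * r`.
  have h3 := rpow_one_add_le_one_add_mul_self (s := q - 1) (by linarith)
    (h.1.r_nonneg k hk) (h.1.r_le_one k hk)
  rw [add_sub_cancel] at h3
  linarith

end LinearProgram

/-! ### Feasibility and ratio of SA1. -/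

section FirstAlgorithm

open scoped Classical

variable {S V U : Type*} [Fintype S] [Fintype V]

theorem one_sub_div_pow_levelSlots_mem (I : SPSC S V U) {β : ℝ}
    {p : S → V → ℝ} (hp : ∀ i j, 0 ≤ p i j) {F : Finset S} {i : S} {j : V} {q : ℕ}
    (hq : i ∈ I.sizeClass β j (.level q)) :
    0 ≤ (1 - p i j / I.classMass β p j (.level q)) ^ I.levelSlots β p F j q ∧
    (1 - p i j / I.classMass β p j (.level q)) ^ I.levelSlots β p F j q ≤
      Real.exp (-(delta β * I.cap j / (∑ i ∈ F, I.size i * p i j) * p i j)) :=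
  ⟨pow_nonneg (sub_nonneg.2 (I.div_classMass_le_one β hp hq)) _,
    one_sub_div_pow_ceil_le (hp i j) (I.le_classMass β hp hq)⟩

theorem finite_slots1 (I : SPSC S V U) {β : ℝ} (h0 : 0 < β) (h1 : β < 1)
    (hs : ∀ i, 0 < I.size i) (p : S → V → ℝ) : (I.slots1 β p).Finite := by
  refine (Set.finite_iUnion fun j => ((I.finite_levels h0 h1 hs j).biUnion fun q _ =>
    (Set.finite_Iio (I.numSlots1 β p j q)).image fun t =>
      (⟨j, .level q, t⟩ : Slot V))).subset ?_
  rintro ⟨j, l, t⟩ ⟨q, -, rfl, hne, hlt⟩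
  simp only [Set.mem_iUnion]
  exact ⟨j, q, hne, t, hlt, rfl⟩

theorem exists_isSA1Output (I : SPSC S V U) {β : ℝ} (h0 : 0 < β) (h1 : β < 1)
    (hs : ∀ i, 0 < I.size i) (hc : ∀ j, 0 ≤ I.cap j) : ∃ X, I.IsSA1Output β X := by
  obtain ⟨p, hp⟩ := I.exists_isLPSolution hc
  obtain ⟨X, hX⟩ := I.exists_isFillOutput β p (I.finite_slots1 h0 h1 hs p)
  exact ⟨X, p, hp, hX⟩

theorem IsSA1Output.feasible {I : SPSC S V U} {β : ℝ} (h0 : 0 < β) (h1 : β < 1)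
    (hs : ∀ i, 0 < I.size i) (hc : ∀ j, 0 ≤ I.cap j) (hw : ∀ k ∈ I.users, 0 ≤ I.weight k)
    {X : S → Finset V} (h : I.IsSA1Output β X) : I.Feasible X := by
  obtain ⟨p, ⟨r, hpr⟩, hfill⟩ := h
  have hp := hpr.1.p_nonneg
  obtain ⟨G, hG, -, hsize⟩ := hfill.exists_finset hs hw hp
  intro j
  refine (hsize j (I.slotSize β) (fun σ _ => I.slotSize_nonneg h0 h1 hc σ)
    fun σ _ i hi => I.size_le_slotSize hi).trans ?_
  -- `numSlots1` is by definition `levelSlots` with `F = univ`.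
  refine I.sum_slotSize_le h0 h1 hs hp hc (F := Finset.univ)
    (fun q => Finset.subset_univ _) fun σ hσ => ?_
  rw [Finset.mem_filter, hG] at hσ
  obtain ⟨⟨q, hq, hl, hne, hlt⟩, rfl⟩ := hσ
  exact ⟨rfl, q, hq, hl, hne, hlt⟩

theorem IsSA1Output.mul_opt_le {I : SPSC S V U} {β : ℝ} (h0 : 0 < β) (h1 : β < 1)
    (hs : ∀ i, 0 < I.size i) (hc : ∀ j, 0 ≤ I.cap j) (hw : ∀ k ∈ I.users, 0 ≤ I.weight k)
    (hβ : ∀ i j, I.size i ≤ I.cap j * β) {X : S → Finset V} (h : I.IsSA1Output β X) :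
    (1 - Real.exp (-delta β)) * I.opt ≤ I.reward X := by
  obtain ⟨p, ⟨r, hpr⟩, hfill⟩ := h
  have hp := hpr.1.p_nonneg
  obtain ⟨G, hG, hrew, -⟩ := hfill.exists_finset hs hw hp
  refine le_trans ?_ hrew
  have hδ : 0 ≤ delta β := sq_nonneg _
  choose q hq using fun i j => I.exists_level h0 h1 (hs i) (hβ i j)
  -- By `hβ` every service has exactly one level on every node, so the slots on `j` open to `i` are
  -- those of one class.
  have key : ∀ i j, ∏ σ ∈ G.filter (fun σ => σ.node = j ∧ i ∈ I.sizeClass β σ.node σ.label),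
      (1 - p i σ.node / I.classMass β p σ.node σ.label) =
      (1 - p i j / I.classMass β p j (.level (q i j))) ^
        I.levelSlots β p Finset.univ j (q i j) := by
    intro i j
    refine prod_slots_eq_pow (l := .level (q i j)) (fun σ => ?_)
      fun j l => 1 - p i j / I.classMass β p j l
    rw [Finset.mem_filter, hG]
    obtain ⟨j', l, t⟩ := σ
    constructor
    · rintro ⟨⟨q', hq', rfl, -, hlt⟩, rfl, hi⟩
      obtain rfl := I.level_unique h0 h1 (hs i) hi (hq i j')
      exact ⟨rfl, rfl, hlt⟩
    · rintro ⟨hj, hl, hlt⟩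
      dsimp only at hj hl hlt
      subst hj
      subst hl
      exact ⟨⟨_, (Finset.mem_filter.1 (hq i j')).2.1, rfl, ⟨i, hq i j'⟩, hlt⟩, rfl, hq i j'⟩
  have hcomb := hpr.mul_opt_le hs hc hw (Real.exp_pos (-delta β))
    (Real.exp_le_one_iff.2 (neg_nonpos.2 hδ))
    (a := fun i j => (1 - p i j / I.classMass β p j (.level (q i j))) ^
      I.levelSlots β p Finset.univ j (q i j))
    (fun i j => (I.one_sub_div_pow_levelSlots_mem hp (hq i j)).1)
    fun i j => by
      refine (I.one_sub_div_pow_levelSlots_mem hp (hq i j)).2.trans ?_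
      -- What remains is `δ * p ≤ ν * p`, where `ν ≥ δ` because the LP load of `j` is at most its
      -- capacity. The case `p = 0` is separate since the load may then vanish.
      rw [← Real.exp_mul, Real.exp_le_exp, neg_mul, neg_le_neg_iff]
      have hA : I.size i * p i j ≤ ∑ i, I.size i * p i j :=
        Finset.single_le_sum (f := fun i => I.size i * p i j)
          (fun i _ => mul_nonneg (hs i).le (hp i j)) (Finset.mem_univ i)
      have hAc : ∑ i, I.size i * p i j ≤ I.cap j := by
        simpa only [mul_comm] using hpr.1.cap_le j
      rcases (hp i j).eq_or_lt with hz | hz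
      · simp [← hz]
      · have hApos : 0 < ∑ i, I.size i * p i j := (mul_pos (hs i) hz).trans_le hA
        refine mul_le_mul_of_nonneg_right ?_ hz.le
        rw [le_div_iff₀ hApos]
        exact mul_le_mul_of_nonneg_left hAc hδ
  refine hcomb.trans (le_of_eq (Finset.sum_congr rfl fun k _ => ?_))
  congr 2
  rw [prod_slots_eq]
  exact Finset.prod_congr rfl fun j _ => (key _ j).symm

end FirstAlgorithm

/-! ### Numerical estimates for SA2. -/

section Estimates

theorem delta_quarter : delta (1 / 4) = 1 / 4 := by
  have : √(1 / 4 : ℝ) = 1 / 2 := by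
    rw [show (1 / 4 : ℝ) = (1 / 2) ^ 2 by norm_num]
    exact Real.sqrt_sq (by norm_num)
  rw [delta, this]
  norm_num

/-- `(1 + y + y²/2) * (1 - y + y²/2) = 1 + y⁴/4 ≥ 1`. -/
theorem exp_neg_le_quadratic {y : ℝ} (hy : 0 ≤ y) : Real.exp (-y) ≤ 1 - y + y ^ 2 / 2 := by
  have h := Real.quadratic_le_exp_of_nonneg hy
  rw [Real.exp_neg, inv_le_iff_one_le_mul₀ (Real.exp_pos y)]
  have h1 : 0 ≤ 1 - y + y ^ 2 / 2 := by nlinarith [sq_nonneg (y - 1)]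
  have h2 := mul_le_mul_of_nonneg_left h h1
  nlinarith [sq_nonneg (y ^ 2)]

theorem exp_neg_three_sixteenths_le : Real.exp (-(3 / 16)) ≤ 1 - (1 - Real.exp (-1)) / 4 := by
  have h1 := exp_neg_le_quadratic (y := 3 / 16) (by norm_num)
  have h2 := Real.exp_neg_one_gt_d9
  norm_num at h1 h2 ⊢
  linarith

/-- In the application `x` is the fraction of the capacity that small services use in the LP, `w`
the probability of mode `three`, and `y = 1 / (4 * x)` the factor `ν`. For `y ≥ 1` the part `1 / 4`
of `w` suffices; for smaller `y` the part `x / 2` compensates. -/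
theorem ratio_le_mul_one_sub_exp {x w : ℝ} (hx : 0 < x) (hx1 : x ≤ 1) (hw : 1 / 4 + x / 2 ≤ w) :
    (1 - Real.exp (-1)) / 4 ≤ w * (1 - Real.exp (-(1 / (4 * x)))) := by
  set y := 1 / (4 * x) with hy
  have hy0 : 0 < y := by positivity
  have hxy : x * y = 1 / 4 := by rw [hy]; field_simp
  have hE : 0 ≤ 1 - Real.exp (-y) := sub_nonneg.2 (Real.exp_le_one_iff.2 (by linarith))
  refine le_trans ?_ (mul_le_mul_of_nonneg_right hw hE)
  rcases le_total 1 y with h | h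
  · have h1 : Real.exp (-y) ≤ Real.exp (-1) := Real.exp_le_exp.2 (by linarith)
    have h2 : 0 ≤ x / 2 * (1 - Real.exp (-y)) := by positivity
    linarith
  · have h1 := exp_neg_le_quadratic hy0.le
    have h2 := Real.exp_neg_one_gt_d9
    have hy4 : 1 / 4 ≤ y := by
      rw [← hxy]; exact mul_le_of_le_one_left hy0.le hx1
    have h3 : (1 / 4 + x / 2) * (y - y ^ 2 / 2) ≤ (1 / 4 + x / 2) * (1 - Real.exp (-y)) :=
      mul_le_mul_of_nonneg_left (by linarith) (by positivity)
    have h4 : (1 / 4 + x / 2) * (y - y ^ 2 / 2) = 1 / 8 + 3 / 16 * y - y ^ 2 / 8 := by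
      linear_combination (1 / 2 - y / 4) * hxy
    -- Hence `y² ≤ 5y/4 - 1/4`, and the quadratic in `h4` is at least `5/32 + y/32 ≥ 21/128 > (1 -
    -- e⁻¹) / 4`.
    have h5 : 0 ≤ (y - 1 / 4) * (1 - y) := mul_nonneg (by linarith) (by linarith)
    norm_num at h2
    nlinarith

/-- Concavity of the power `t` between `1` and `y`. It pulls the exponent `p i j` out of the mixture
over modes. -/
theorem one_sub_add_mul_rpow_le {w y t : ℝ} (hw0 : 0 ≤ w) (hw1 : w ≤ 1) (hy : 0 ≤ y)
    (ht0 : 0 ≤ t) (ht1 : t ≤ 1) : 1 - w + w * y ^ t ≤ (1 - w + w * y) ^ t := by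
  have h := (Real.concaveOn_rpow ht0 ht1).2 (x := 1) (y := y) (Set.mem_Ici.2 zero_le_one)
    (Set.mem_Ici.2 hy) (sub_nonneg.2 hw1) hw0 (by ring)
  simpa using h

end Estimates

/-! ### Feasibility and ratio of SA2. -/

section SecondAlgorithm

open scoped Classical

variable {S V U : Type*} [Fintype S] [Fintype V]

/-- The set of small services on a node in the second algorithm. -/
def smallServices (I : SPSC S V U) (j : V) : Finset S :=
  Finset.univ.filter fun i => I.size i ≤ I.cap j * (1 / 4)

/-- The LP capacity constraint split by size: services of class `⊕` exceed `c / 2`, those of class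
`⊖` exceed `c / 4`, and `x` is the share of the small ones. Capacity `0`, possible in a repetition,
forces `p = 0` through `too_large`. -/
theorem LPFeasible.mass_le {I : SPSC S V U} (hs : ∀ i, 0 < I.size i) (hc : ∀ j, 0 ≤ I.cap j)
    {p : S → V → ℝ} {r : U → ℝ} (h : I.LPFeasible p r) (j : V) :
    ∃ x, 0 ≤ x ∧ ∑ i ∈ I.smallServices j, I.size i * p i j = x * I.cap j ∧
      I.classMass (1 / 4) p j .plus / 2 + I.classMass (1 / 4) p j .minus / 4 + x ≤ 1 := by
  have hp := h.p_nonneg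
  have hA : 0 ≤ ∑ i ∈ I.smallServices j, I.size i * p i j :=
    Finset.sum_nonneg fun i _ => mul_nonneg (hs i).le (hp i j)
  rcases (hc j).eq_or_lt with hcj | hcj
  · have hz : ∀ i, p i j = 0 := fun i => h.too_large i j (hcj ▸ hs i)
    exact ⟨0, le_rfl, by simp [hz], by simp [classMass, hz]⟩
  · refine ⟨(∑ i ∈ I.smallServices j, I.size i * p i j) / I.cap j, div_nonneg hA hcj.le,
      (div_mul_cancel₀ _ hcj.ne').symm, ?_⟩
    have key : I.classMass (1 / 4) p j .plus * (I.cap j / 2) +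
        I.classMass (1 / 4) p j .minus * (I.cap j / 4) +
        ∑ i ∈ I.smallServices j, I.size i * p i j ≤ I.cap j := by
      refine le_trans ?_ (h.cap_le j)
      rw [classMass, classMass, Finset.sum_mul, Finset.sum_mul, sizeClass, sizeClass,
        smallServices, Finset.sum_filter, Finset.sum_filter, Finset.sum_filter,
        ← Finset.sum_add_distrib, ← Finset.sum_add_distrib]
      refine Finset.sum_le_sum fun i _ => ?_
      have h0 := mul_nonneg (hp i j) (hs i).le
      split_ifs with h1 h2 h3 h3 h2 h3 h3
      · linarith [h1.1, h2.2]
      · linarith [h1.1, h2.2]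
      · linarith [h1.1]
      · linarith [mul_le_mul_of_nonneg_left h1.1.le (hp i j)]
      · linarith [h2.1]
      · linarith [mul_le_mul_of_nonneg_left h2.1.le (hp i j)]
      · linarith
      · linarith
    have := div_le_div_of_nonneg_right key hcj.le
    rw [div_self hcj.ne', add_div, add_div] at this
    refine le_trans (le_of_eq ?_) this
    field_simp

theorem midMass_nonneg (I : SPSC S V U) {p : S → V → ℝ} (hp : ∀ i j, 0 ≤ p i j) (j : V) :
    0 ≤ I.midMass p j := by
  have := I.classMass_nonneg (1 / 4) hp j .minus
  unfold midMass
  split_ifs <;> linarith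

/-- Half of `hx` bounds `d⊕ / 4 + d⊖ / 8` by `(1 - x) / 2`. If `d⊖ < 2`, mode `two` takes a further
`d⊖ / 8 < 1 / 4`; halving the mass in `midMass` for larger `d⊖` removes this excess. -/
theorem le_weight_three {I : SPSC S V U} {p : S → V → ℝ} (hp : ∀ i j, 0 ≤ p i j) {j : V} {x : ℝ}
    (hx : I.classMass (1 / 4) p j .plus / 2 +
      I.classMass (1 / 4) p j .minus / 4 + x ≤ 1) :
    1 / 4 + x / 2 ≤ 1 - delta (1 / 4) * I.classMass (1 / 4) p j .plus -
      delta (1 / 4) * I.midMass p j := by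
  have h1 := I.classMass_nonneg (1 / 4) hp j .plus
  have h2 := I.classMass_nonneg (1 / 4) hp j .minus
  rw [delta_quarter]
  unfold midMass
  split_ifs <;> linarith

theorem placeProbMode_mem (I : SPSC S V U) {p : S → V → ℝ} (hp : ∀ i j, 0 ≤ p i j) (i : S)
    (j : V) (a : NodeMode) : 0 ≤ I.placeProbMode p i j a ∧ I.placeProbMode p i j a ≤ 1 := by
  have key : ∀ l, i ∈ I.sizeClass (1 / 4) j l → ∀ n : ℕ,
      0 ≤ 1 - (1 - p i j / I.classMass (1 / 4) p j l) ^ n ∧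
      1 - (1 - p i j / I.classMass (1 / 4) p j l) ^ n ≤ 1 := by
    intro l hl n
    have h1 : 0 ≤ 1 - p i j / I.classMass (1 / 4) p j l :=
      sub_nonneg.2 (I.div_classMass_le_one (1 / 4) hp hl)
    have h2 : 1 - p i j / I.classMass (1 / 4) p j l ≤ 1 :=
      sub_le_self _ (div_nonneg (hp i j) (I.classMass_nonneg (1 / 4) hp j l))
    exact ⟨sub_nonneg.2 (pow_le_one₀ h1 h2), sub_le_self _ (pow_nonneg h1 n)⟩
  cases a <;> simp only [placeProbMode]
  · split_ifs with h
    · simpa using key _ h 1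
    · simp
  · split_ifs with h
    · exact key _ h 2
    · simp
  · split_ifs with h
    · exact key _ h.choose_spec _
    · simp

/-- The probability of each mode if the modes are chosen at random. -/
def modeWeight (I : SPSC S V U) (p : S → V → ℝ) (j : V) : NodeMode → ℝ
  | .one => delta (1 / 4) * I.classMass (1 / 4) p j .plus
  | .two => delta (1 / 4) * I.midMass p j
  | .three => 1 - delta (1 / 4) * I.classMass (1 / 4) p j .plus - delta (1 / 4) * I.midMass p j

theorem LPFeasible.modeWeight_nonneg {I : SPSC S V U} (hs : ∀ i, 0 < I.size i)
    (hc : ∀ j, 0 ≤ I.cap j) {p : S → V → ℝ} {r : U → ℝ} (h : I.LPFeasible p r) (j : V)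
    (a : NodeMode) : 0 ≤ I.modeWeight p j a := by
  have h0 : (0 : ℝ) ≤ delta (1 / 4) := sq_nonneg _
  cases a
  · exact mul_nonneg h0 (I.classMass_nonneg _ h.p_nonneg j _)
  · exact mul_nonneg h0 (I.midMass_nonneg h.p_nonneg j)
  · obtain ⟨x, hx0, -, hx⟩ := h.mass_le hs hc j
    have := le_weight_three h.p_nonneg hx
    simp only [modeWeight]
    linarith

theorem LPFeasible.mul_placeProbMode_le {I : SPSC S V U} (hs : ∀ i, 0 < I.size i)
    (hc : ∀ j, 0 ≤ I.cap j) {p : S → V → ℝ} {r : U → ℝ} (h : I.LPFeasible p r) (i : S) (j : V)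
    (a : NodeMode) :
    I.modeWeight p j a * I.placeProbMode p i j a ≤ I.placeProb p i j none := by
  have hnn := fun a => mul_nonneg (h.modeWeight_nonneg hs hc j a)
    (I.placeProbMode_mem h.p_nonneg i j a).1
  have h1 := hnn .one
  have h2 := hnn .two
  have h3 := hnn .three
  simp only [modeWeight] at h1 h2 h3
  cases a <;> simp only [modeWeight, placeProb] <;> linarith

theorem LPFeasible.placeProb_none_le_one {I : SPSC S V U} (hs : ∀ i, 0 < I.size i)
    (hc : ∀ j, 0 ≤ I.cap j) {p : S → V → ℝ} {r : U → ℝ} (h : I.LPFeasible p r) (i : S)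
    (j : V) : I.placeProb p i j none ≤ 1 := by
  have hle := fun a => mul_le_of_le_one_right (h.modeWeight_nonneg hs hc j a)
    (I.placeProbMode_mem h.p_nonneg i j a).2
  have h1 := hle .one
  have h2 := hle .two
  have h3 := hle .three
  simp only [modeWeight] at h1 h2 h3
  simp only [placeProb]
  linarith

theorem mul_placeProbMode_one {I : SPSC S V U} {p : S → V → ℝ} (hp : ∀ i j, 0 ≤ p i j) {i : S}
    {j : V} (hi : i ∈ I.sizeClass (1 / 4) j .plus) :
    3 / 16 * p i j ≤ I.modeWeight p j .one * I.placeProbMode p i j .one := by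
  have h1 := I.le_classMass (1 / 4) hp hi
  simp only [modeWeight, placeProbMode, if_pos hi, delta_quarter]
  rcases (hp i j).eq_or_lt with h0 | h0
  · simp [← h0]
  · have := h0.trans_le h1
    rw [mul_assoc, mul_div_cancel₀ _ this.ne']
    linarith

/-- Without halving, `(2p - p²/d) / 4 ≥ p / 4`. With halving, `d ≥ 2` and `p ≤ 1` give `p / d ≤ 1 /
2`, so `(2p - p²/d) / 8 ≥ 3p / 16`; this is where the constant comes from. -/
theorem mul_placeProbMode_two {I : SPSC S V U} {p : S → V → ℝ} (hp : ∀ i j, 0 ≤ p i j)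
    (hp1 : ∀ i j, p i j ≤ 1) {i : S} {j : V} (hi : i ∈ I.sizeClass (1 / 4) j .minus) :
    3 / 16 * p i j ≤ I.modeWeight p j .two * I.placeProbMode p i j .two := by
  have h1 := I.le_classMass (1 / 4) hp hi
  simp only [modeWeight, placeProbMode, if_pos hi, delta_quarter, midMass]
  rcases (hp i j).eq_or_lt with h0 | h0
  · simp [← h0]
  · set d := I.classMass (1 / 4) p j .minus
    have hd : 0 < d := h0.trans_le h1
    have e : d * (1 - (1 - p i j / d) ^ 2) = 2 * p i j - p i j * (p i j / d) := by
      field_simp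
      ring
    split_ifs with h2
    · have h3 := mul_le_of_le_one_right h0.le (div_le_one_of_le₀ h1 hd.le)
      linarith
    · have h4 : p i j / d ≤ 1 / 2 := by
        rw [div_le_iff₀ hd]; linarith [hp1 i j]
      have h3 := mul_le_mul_of_nonneg_left h4 h0.le
      linarith

/-- A service of positive mass fits on `j`, so it is large, medium or small there, and the mode
serving its class alone gives the bound. For the first two, `1 - 3p/16 ≤ exp (-3p/16)` suffices. -/
theorem LPFeasible.one_sub_placeProb_none_le {I : SPSC S V U} (hs : ∀ i, 0 < I.size i)
    (hc : ∀ j, 0 ≤ I.cap j) {p : S → V → ℝ} {r : U → ℝ} (h : I.LPFeasible p r) (i : S)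
    (j : V) : 1 - I.placeProb p i j none ≤ (1 - (1 - Real.exp (-1)) / 4) ^ p i j := by
  have hp := h.p_nonneg
  have hlarge : 3 / 16 * p i j ≤ I.placeProb p i j none →
      1 - I.placeProb p i j none ≤ (1 - (1 - Real.exp (-1)) / 4) ^ p i j := by
    intro hle
    refine le_trans ?_ (Real.rpow_le_rpow (Real.exp_pos _).le exp_neg_three_sixteenths_le
      (hp i j))
    rw [← Real.exp_mul]
    have := Real.add_one_le_exp (-(3 / 16) * p i j)
    linarith
  by_cases h0 : p i j = 0
  · have hnn := (mul_nonneg (h.modeWeight_nonneg hs hc j .one)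
      (I.placeProbMode_mem hp i j .one).1).trans (h.mul_placeProbMode_le hs hc i j .one)
    simpa [h0] using hnn
  have hsc : I.size i ≤ I.cap j := by
    by_contra! hlt
    exact h0 (h.too_large i j hlt)
  rcases lt_or_ge (1 / 2 * I.cap j) (I.size i) with h1 | h1
  · exact hlarge ((mul_placeProbMode_one hp
      (Finset.mem_filter.2 ⟨Finset.mem_univ _, h1, hsc⟩)).trans
      (h.mul_placeProbMode_le hs hc i j .one))
  rcases lt_or_ge (I.cap j * (1 / 4)) (I.size i) with h2 | h2
  · exact hlarge ((mul_placeProbMode_two hp h.p_le_one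
      (Finset.mem_filter.2 ⟨Finset.mem_univ _, h2, h1⟩)).trans
      (h.mul_placeProbMode_le hs hc i j .two))
  have hlev := I.exists_level (β := 1 / 4) (by norm_num) (by norm_num) (hs i) h2
  obtain ⟨x, hx0, hxA, hx⟩ := h.mass_le hs hc j
  have hcj : 0 < I.cap j := (hs i).trans_le hsc
  have hpos : 0 < p i j := lt_of_le_of_ne (hp i j) (Ne.symm h0)
  have hA : 0 < ∑ i ∈ I.smallServices j, I.size i * p i j :=
    (mul_pos (hs i) hpos).trans_le (Finset.single_le_sum (f := fun i => I.size i * p i j)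
      (fun i _ => mul_nonneg (hs i).le (hp i j))
      (Finset.mem_filter.2 ⟨Finset.mem_univ _, h2⟩))
  have hxpos : 0 < x := by
    rw [hxA] at hA
    exact pos_of_mul_pos_left hA hcj.le
  have hx1 : x ≤ 1 := by
    have := I.classMass_nonneg (1 / 4) hp j .plus
    have := I.classMass_nonneg (1 / 4) hp j .minus
    linarith
  have hw := le_weight_three hp hx
  have hw1 : I.modeWeight p j .three ≤ 1 := by
    have := h.modeWeight_nonneg hs hc j .one
    have := h.modeWeight_nonneg hs hc j .two
    simp only [modeWeight] at *
    linarith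
  have hw0 := h.modeWeight_nonneg hs hc j .three
  -- `numSlots2` is `levelSlots` over `smallServices`, and `ν = (c / 4) / (x c) = 1 / (4 * x)`.
  have h3 : (1 - p i j / I.classMass (1 / 4) p j (.level hlev.choose)) ^
      I.numSlots2 p j hlev.choose ≤ Real.exp (-(1 / (4 * x))) ^ p i j := by
    refine ((I.one_sub_div_pow_levelSlots_mem (F := I.smallServices j) hp
      hlev.choose_spec).2).trans (le_of_eq ?_)
    rw [← Real.exp_mul, hxA, delta_quarter]
    congr 1
    field_simp
  have h4 := h.mul_placeProbMode_le hs hc i j .three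
  simp only [placeProbMode, dif_pos hlev] at h4
  have h5 := one_sub_add_mul_rpow_le hw0 hw1 (Real.exp_pos (-(1 / (4 * x)))).le (hp i j)
    (h.p_le_one i j)
  have h6 := mul_le_mul_of_nonneg_left h3 hw0
  have h7 : 1 - I.placeProb p i j none ≤ (1 - I.modeWeight p j .three +
      I.modeWeight p j .three * Real.exp (-(1 / (4 * x)))) ^ p i j := by linarith
  refine h7.trans (Real.rpow_le_rpow ?_ ?_ (hp i j))
  · have := mul_nonneg hw0 (Real.exp_pos (-(1 / (4 * x)))).le
    linarith
  · have := ratio_le_mul_one_sub_exp hxpos hx1 hw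
    simp only [modeWeight]
    linarith

/-- The value is affine in the placement probability at `j`, and the probability for an undecided
mode is the average with weights `modeWeight`, which sum to `1`. -/
theorem expRewardMap_eq_average (I : SPSC S V U) (p : S → V → ℝ) {ζ : V → Option NodeMode}
    {j : V} (hζ : ζ j = none) :
    I.expRewardMap p ζ =
      I.modeWeight p j .one * I.expRewardMap p (Function.update ζ j (some .one)) +
      I.modeWeight p j .two * I.expRewardMap p (Function.update ζ j (some .two)) +
      I.modeWeight p j .three * I.expRewardMap p (Function.update ζ j (some .three)) := by
  simp only [expRewardMap, Finset.mul_sum, ← Finset.sum_add_distrib]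
  refine Finset.sum_congr rfl fun k _ => ?_
  by_cases hj : j ∈ I.nodes k
  · have hup : ∀ a, ∏ j' ∈ (I.nodes k).erase j,
        (1 - I.placeProb p (I.service k) j' (Function.update ζ j (some a) j')) =
        ∏ j' ∈ (I.nodes k).erase j, (1 - I.placeProb p (I.service k) j' (ζ j')) := by
      intro a
      refine Finset.prod_congr rfl fun j' hj' => ?_
      rw [Function.update_of_ne (Finset.ne_of_mem_erase hj')]
    simp only [← Finset.mul_prod_erase _ _ hj, hup, Function.update_self, hζ]
    generalize ∏ j' ∈ (I.nodes k).erase j, (1 - I.placeProb p (I.service k) j' (ζ j')) = P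
    simp only [placeProb, modeWeight]
    ring
  · have hup : ∀ a, ∏ j' ∈ I.nodes k,
        (1 - I.placeProb p (I.service k) j' (Function.update ζ j (some a) j')) =
        ∏ j' ∈ I.nodes k, (1 - I.placeProb p (I.service k) j' (ζ j')) := by
      intro a
      refine Finset.prod_congr rfl fun j' hj' => ?_
      rw [Function.update_of_ne (by rintro rfl; exact hj hj')]
    simp only [hup, modeWeight]
    ring

theorem ModeRun.expRewardMap_le {I : SPSC S V U} (hs : ∀ i, 0 < I.size i)
    (hc : ∀ j, 0 ≤ I.cap j) {p : S → V → ℝ} {r : U → ℝ} (hpr : I.LPFeasible p r)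
    {todo : List V} {ζ lam : V → Option NodeMode} (h : I.ModeRun p todo ζ lam)
    (hnd : todo.Nodup) (hζ : ∀ j ∈ todo, ζ j = none) :
    I.expRewardMap p ζ ≤ I.expRewardMap p lam := by
  induction h with
  | done ζ => exact le_rfl
  | choose j todo ζ lam a hmax hrest ih =>
    rw [List.nodup_cons] at hnd
    refine le_trans ?_ (ih hnd.2 fun j' hj' => ?_)
    · have key := fun a' => mul_le_mul_of_nonneg_left (hmax a') (hpr.modeWeight_nonneg hs hc j a')
      have h1 := key .one
      have h2 := key .two
      have h3 := key .three
      rw [I.expRewardMap_eq_average p (hζ j (by simp))]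
      simp only [modeWeight] at *
      linarith
    · rw [Function.update_of_ne (by rintro rfl; exact hnd.1 hj'), hζ j' (by simp [hj'])]

theorem ModeRun.eq_of_notMem {I : SPSC S V U} {p : S → V → ℝ} {todo : List V}
    {ζ lam : V → Option NodeMode} (h : I.ModeRun p todo ζ lam) {j : V} (hj : j ∉ todo) :
    lam j = ζ j := by
  induction h with
  | done ζ => rfl
  | choose j' todo ζ lam a hmax hrest ih =>
    simp only [List.mem_cons, not_or] at hj
    rw [ih hj.2, Function.update_of_ne hj.1]

theorem ModeRun.exists_eq_some {I : SPSC S V U} {p : S → V → ℝ} {todo : List V}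
    {ζ lam : V → Option NodeMode} (h : I.ModeRun p todo ζ lam) {j : V} (hj : j ∈ todo) :
    ∃ a, lam j = some a := by
  induction h with
  | done ζ => simp at hj
  | choose j' todo ζ lam a hmax hrest ih =>
    by_cases hj' : j ∈ todo
    · exact ih hj'
    · obtain rfl : j = j' := (List.mem_cons.1 hj).resolve_right hj'
      exact ⟨a, by rw [hrest.eq_of_notMem hj', Function.update_self]⟩

theorem exists_modeRun (I : SPSC S V U) (p : S → V → ℝ) (todo : List V)
    (ζ : V → Option NodeMode) : ∃ lam, I.ModeRun p todo ζ lam := by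
  induction todo generalizing ζ with
  | nil => exact ⟨ζ, .done ζ⟩
  | cons j todo ih =>
    have hfin : (Set.univ : Set NodeMode).Finite :=
      (Set.toFinite {NodeMode.one, .two, .three}).subset fun a _ => by cases a <;> simp
    obtain ⟨a, -, ha⟩ := Set.exists_max_image _
      (fun a => I.expRewardMap p (Function.update ζ j (some a))) hfin ⟨.one, trivial⟩
    obtain ⟨lam, hlam⟩ := ih (Function.update ζ j (some a))
    exact ⟨lam, .choose j todo ζ lam a (fun a' => ha a' trivial) hlam⟩

theorem finite_slots2 (I : SPSC S V U) (hs : ∀ i, 0 < I.size i) (p : S → V → ℝ)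
    (lam : V → Option NodeMode) : (I.slots2 p lam).Finite := by
  refine (Set.finite_iUnion fun j => ((((Set.finite_Iio 1).image fun t =>
      (⟨j, .plus, t⟩ : Slot V)).union ((Set.finite_Iio 2).image fun t =>
      (⟨j, .minus, t⟩ : Slot V))).union
      ((I.finite_levels (β := 1 / 4) (by norm_num) (by norm_num) hs j).biUnion fun q _ =>
    (Set.finite_Iio (I.numSlots2 p j q)).image fun t =>
      (⟨j, .level q, t⟩ : Slot V)))).subset ?_
  rintro ⟨j, l, t⟩ h
  refine Set.mem_iUnion.2 ⟨j, ?_⟩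
  rcases h with ⟨-, rfl, hlt⟩ | ⟨-, rfl, hlt⟩ | ⟨-, q, -, rfl, hne, hlt⟩
  · exact .inl (.inl ⟨t, hlt, rfl⟩)
  · exact .inl (.inr ⟨t, hlt, rfl⟩)
  · exact .inr (Set.mem_biUnion hne ⟨t, hlt, rfl⟩)

theorem exists_isSA2Output (I : SPSC S V U) (hs : ∀ i, 0 < I.size i) (hc : ∀ j, 0 ≤ I.cap j) :
    ∃ X, I.IsSA2Output X := by
  obtain ⟨p, hp⟩ := I.exists_isLPSolution hc
  obtain ⟨lam, hlam⟩ := I.exists_modeRun p Finset.univ.toList fun _ => none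
  obtain ⟨X, hX⟩ := I.exists_isFillOutput (1 / 4) p (I.finite_slots2 hs p lam)
  exact ⟨X, p, hp, _, lam, Finset.nodup_toList _, by simp, hlam, hX⟩

theorem sum_slotSize_le_mul (I : SPSC S V U) {β : ℝ} {G : Finset (Slot V)} {j : V}
    {l : SlotLabel} {n : ℕ} (hG : ∀ σ ∈ G, σ.node = j ∧ σ.label = l ∧ σ.idx < n)
    (h0 : 0 ≤ I.slotSize β ⟨j, l, 0⟩) :
    ∑ σ ∈ G, I.slotSize β σ ≤ n * I.slotSize β ⟨j, l, 0⟩ := by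
  have hsub : G ⊆ (Finset.range n).image fun t => ⟨j, l, t⟩ := by
    rintro ⟨j', l', t⟩ hσ
    obtain ⟨rfl, rfl, hlt⟩ := hG _ hσ
    exact Finset.mem_image.2 ⟨t, Finset.mem_range.2 hlt, rfl⟩
  have hcard : G.card ≤ n :=
    (Finset.card_le_card hsub).trans (Finset.card_image_le.trans (Finset.card_range n).le)
  have heq : ∀ σ ∈ G, I.slotSize β σ = I.slotSize β ⟨j, l, 0⟩ := by
    rintro ⟨j', l', t⟩ hσ
    obtain ⟨rfl, rfl, -⟩ := hG _ hσ
    rfl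
  rw [Finset.sum_congr rfl heq, Finset.sum_const, nsmul_eq_mul]
  exact mul_le_mul_of_nonneg_right (by exact_mod_cast hcard) h0

theorem IsSA2Output.feasible {I : SPSC S V U} (hs : ∀ i, 0 < I.size i) (hc : ∀ j, 0 ≤ I.cap j)
    (hw : ∀ k ∈ I.users, 0 ≤ I.weight k) {X : S → Finset V} (h : I.IsSA2Output X) :
    I.Feasible X := by
  have hβ0 : (0 : ℝ) < 1 / 4 := by norm_num
  have hβ1 : (1 / 4 : ℝ) < 1 := by norm_num
  obtain ⟨p, ⟨r, hpr⟩, todo, lam, -, htodo, hrun, hfill⟩ := h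
  have hp := hpr.1.p_nonneg
  obtain ⟨G, hG, -, hsize⟩ := hfill.exists_finset hs hw hp
  intro j
  refine (hsize j (I.slotSize (1 / 4)) (fun σ _ => I.slotSize_nonneg hβ0 hβ1 hc σ)
    fun σ _ i hi => I.size_le_slotSize hi).trans ?_
  obtain ⟨a, ha⟩ := hrun.exists_eq_some (htodo j)
  have hnn := fun l => I.slotSize_nonneg hβ0 hβ1 hc ⟨j, l, 0⟩
  -- Each mode alone fits: one slot of size `c`, two of size `c / 2`, or the small levels.
  cases a
  · refine (I.sum_slotSize_le_mul (l := .plus) (n := 1) (fun σ hσ => ?_) (hnn _)).trans ?_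
    · rw [Finset.mem_filter, hG] at hσ
      obtain ⟨hσ, rfl⟩ := hσ
      simpa [slots2, ha] using hσ
    · simp [slotSize]
  · refine (I.sum_slotSize_le_mul (l := .minus) (n := 2) (fun σ hσ => ?_) (hnn _)).trans ?_
    · rw [Finset.mem_filter, hG] at hσ
      obtain ⟨hσ, rfl⟩ := hσ
      simpa [slots2, ha] using hσ
    · simp [slotSize]
  · refine I.sum_slotSize_le hβ0 hβ1 hs hp hc (F := I.smallServices j) (fun q i hi =>
      Finset.mem_filter.2 ⟨Finset.mem_univ _, I.size_le_of_mem_level hβ0 hβ1 (hs i) hi⟩)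
      fun σ hσ => ?_
    rw [Finset.mem_filter, hG] at hσ
    obtain ⟨hσ, rfl⟩ := hσ
    refine ⟨rfl, ?_⟩
    rcases hσ with ⟨h, -⟩ | ⟨h, -⟩ | ⟨-, h⟩
    · simp [ha] at h
    · simp [ha] at h
    · exact h

/-- The modes are constructed so that random filling places a service with the computed
probability. -/
theorem prod_slots2_eq (I : SPSC S V U) (hs : ∀ i, 0 < I.size i) (p : S → V → ℝ)
    {lam : V → Option NodeMode} {G : Finset (Slot V)} (hG : ∀ σ, σ ∈ G ↔ σ ∈ I.slots2 p lam)
    (i : S) (j : V) {a : NodeMode} (ha : lam j = some a) :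
    ∏ σ ∈ G.filter (fun σ => σ.node = j ∧ i ∈ I.sizeClass (1 / 4) σ.node σ.label),
      (1 - p i σ.node / I.classMass (1 / 4) p σ.node σ.label) =
    1 - I.placeProb p i j (lam j) := by
  rw [ha]
  have hslot : ∀ l t, (⟨j, l, t⟩ : Slot V) ∈ G ↔ (a = .one ∧ l = .plus ∧ t < 1) ∨
      (a = .two ∧ l = .minus ∧ t < 2) ∨ (a = .three ∧ ∃ q, 1 ≤ q ∧ l = .level q ∧
        (I.sizeClass (1 / 4) j (.level q)).Nonempty ∧ t < I.numSlots2 p j q) := by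
    intro l t
    rw [hG]
    simp [slots2, ha]
  have hpow : ∀ l n, (∀ l' t, (⟨j, l', t⟩ : Slot V) ∈ G ∧ i ∈ I.sizeClass (1 / 4) j l' ↔
      l' = l ∧ t < n) → ∏ σ ∈ G.filter (fun σ => σ.node = j ∧
        i ∈ I.sizeClass (1 / 4) σ.node σ.label),
      (1 - p i σ.node / I.classMass (1 / 4) p σ.node σ.label) =
      (1 - p i j / I.classMass (1 / 4) p j l) ^ n := by
    intro l n h
    refine prod_slots_eq_pow (l := l) (fun σ => ?_)
      fun j l => 1 - p i j / I.classMass (1 / 4) p j l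
    obtain ⟨j', l', t⟩ := σ
    rw [Finset.mem_filter]
    constructor
    · rintro ⟨h1, rfl, h2⟩; exact ⟨rfl, (h l' t).1 ⟨h1, h2⟩⟩
    · rintro ⟨rfl, h2⟩
      have := (h l' t).2 h2
      exact ⟨this.1, rfl, this.2⟩
  have hempty : (∀ l' t, (⟨j, l', t⟩ : Slot V) ∈ G → i ∉ I.sizeClass (1 / 4) j l') →
      ∏ σ ∈ G.filter (fun σ => σ.node = j ∧ i ∈ I.sizeClass (1 / 4) σ.node σ.label),
      (1 - p i σ.node / I.classMass (1 / 4) p σ.node σ.label) = 1 := by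
    intro h
    rw [Finset.filter_eq_empty_iff.2, Finset.prod_empty]
    rintro ⟨j', l', t⟩ hσ ⟨rfl, h2⟩
    exact h l' t hσ h2
  cases a
  · by_cases hi : i ∈ I.sizeClass (1 / 4) j .plus
    · rw [hpow .plus 1]
      · simp only [placeProb, placeProbMode, if_pos hi, pow_one]
      · intro l' t
        rw [hslot]
        simp only [true_and, reduceCtorEq, false_and, or_false]
        exact ⟨fun h => h.1, fun h => ⟨h, h.1 ▸ hi⟩⟩
    · rw [hempty]
      · simp only [placeProb, placeProbMode, if_neg hi, sub_zero]
      · intro l' t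
        rw [hslot]
        simp only [true_and, reduceCtorEq, false_and, or_false]
        rintro ⟨rfl, -⟩
        exact hi
  · by_cases hi : i ∈ I.sizeClass (1 / 4) j .minus
    · rw [hpow .minus 2]
      · simp only [placeProb, placeProbMode, if_pos hi, sub_sub_cancel]
      · intro l' t
        rw [hslot]
        simp only [true_and, reduceCtorEq, false_and, or_false, false_or]
        exact ⟨fun h => h.1, fun h => ⟨h, h.1 ▸ hi⟩⟩
    · rw [hempty]
      · simp only [placeProb, placeProbMode, if_neg hi, sub_zero]
      · intro l' t
        rw [hslot]
        simp only [true_and, reduceCtorEq, false_and, or_false, false_or]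
        rintro ⟨rfl, -⟩
        exact hi
  · by_cases hi : ∃ q, i ∈ I.sizeClass (1 / 4) j (.level q)
    · rw [hpow (.level hi.choose) (I.numSlots2 p j hi.choose)]
      · simp only [placeProb, placeProbMode, dif_pos hi, sub_sub_cancel]
      · intro l' t
        rw [hslot]
        simp only [true_and, reduceCtorEq, false_and, false_or]
        constructor
        · rintro ⟨⟨q, hq, rfl, -, hlt⟩, hmem⟩
          obtain rfl := I.level_unique (by norm_num) (by norm_num) (hs i) hmem hi.choose_spec
          exact ⟨rfl, hlt⟩
        · rintro ⟨rfl, hlt⟩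
          exact ⟨⟨_, (Finset.mem_filter.1 hi.choose_spec).2.1, rfl, ⟨i, hi.choose_spec⟩, hlt⟩,
            hi.choose_spec⟩
    · rw [hempty]
      · simp only [placeProb, placeProbMode, dif_neg hi, sub_zero]
      · intro l' t
        rw [hslot]
        simp only [true_and, reduceCtorEq, false_and, false_or]
        rintro ⟨q, -, rfl, -⟩ hmem
        exact hi ⟨q, hmem⟩

theorem IsSA2Output.mul_opt_le {I : SPSC S V U} (hs : ∀ i, 0 < I.size i)
    (hc : ∀ j, 0 ≤ I.cap j) (hw : ∀ k ∈ I.users, 0 ≤ I.weight k) {X : S → Finset V}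
    (h : I.IsSA2Output X) : (1 - Real.exp (-1)) / 4 * I.opt ≤ I.reward X := by
  obtain ⟨p, ⟨r, hpr⟩, todo, lam, hnd, htodo, hrun, hfill⟩ := h
  have hp := hpr.1.p_nonneg
  obtain ⟨G, hG, hrew, -⟩ := hfill.exists_finset hs hw hp
  have he0 := Real.exp_pos (-1)
  have he1 : Real.exp (-1) ≤ 1 := Real.exp_le_one_iff.2 (by norm_num)
  have h1 := hpr.mul_opt_le hs hc hw (q := 1 - (1 - Real.exp (-1)) / 4) (by linarith)
    (by linarith) (a := fun i j => 1 - I.placeProb p i j none)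
    (fun i j => sub_nonneg.2 (hpr.1.placeProb_none_le_one hs hc i j))
    fun i j => hpr.1.one_sub_placeProb_none_le hs hc i j
  rw [sub_sub_cancel] at h1
  -- The two derandomizations are chained: the value of the final construction map is the expected
  -- reward before the first slot is filled.
  refine (h1.trans (hrun.expRewardMap_le hs hc hpr.1 hnd fun _ _ => rfl)).trans
    (le_trans (le_of_eq (Finset.sum_congr rfl fun k _ => ?_)) hrew)
  congr 2
  rw [prod_slots_eq]
  refine Finset.prod_congr rfl fun j _ => ?_
  obtain ⟨a, ha⟩ := hrun.exists_eq_some (htodo j)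
  exact (I.prod_slots2_eq hs p hG _ j ha).symm

end SecondAlgorithm

/-! ### The combined algorithm. -/

section Combined

open scoped Classical

variable {S V U : Type*} [Fintype S] [Fintype V] [Nonempty S] [Nonempty V]

theorem maxSize_pos (I : SPSC S V U) (hs : ∀ i, 0 < I.size i) : 0 < I.maxSize :=
  (hs (Classical.arbitrary S)).trans_le (Finset.le_sup' I.size (Finset.mem_univ _))

theorem minCap_pos (I : SPSC S V U) (hc : ∀ j, 0 < I.cap j) : 0 < I.minCap :=
  (Finset.lt_inf'_iff _).2 fun j _ => hc j

theorem beta_pos (I : SPSC S V U) (hs : ∀ i, 0 < I.size i) (h : 0 < I.minCap) : 0 < I.beta :=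
  div_pos (I.maxSize_pos hs) h

theorem size_le_cap_mul_beta (I : SPSC S V U) (hs : ∀ i, 0 < I.size i) (h : 0 < I.minCap)
    (i : S) (j : V) : I.size i ≤ I.cap j * I.beta := by
  have h1 : I.size i ≤ I.maxSize := Finset.le_sup' I.size (Finset.mem_univ i)
  have h2 : I.minCap ≤ I.cap j := Finset.inf'_le I.cap (Finset.mem_univ j)
  have h3 := (I.isLeast_beta h).1
  rw [Set.mem_ofPred_eq] at h3
  have h4 := mul_le_mul_of_nonneg_left h2 (I.beta_pos hs h).le
  linarith

theorem UsesSA1.beta_lt_one {I : SPSC S V U} (h : I.UsesSA1) : I.beta < 1 :=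
  not_le.1 fun h1 => h.2 (.inl h1)

theorem exists_isCSAOutput (I : SPSC S V U) (hs : ∀ i, 0 < I.size i) (hc : ∀ j, 0 ≤ I.cap j) :
    ∃ X, I.IsCSAOutput X := by
  by_cases h : I.UsesSA1
  · obtain ⟨X, hX⟩ := I.exists_isSA1Output (I.beta_pos hs h.1) h.beta_lt_one hs hc
    exact ⟨X, .inl ⟨h, hX⟩⟩
  · obtain ⟨X, hX⟩ := I.exists_isSA2Output hs hc
    exact ⟨X, .inr ⟨h, hX⟩⟩

theorem IsCSAOutput.feasible {I : SPSC S V U} (hs : ∀ i, 0 < I.size i) (hc : ∀ j, 0 ≤ I.cap j)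
    (hw : ∀ k ∈ I.users, 0 ≤ I.weight k) {X : S → Finset V} (h : I.IsCSAOutput X) :
    I.Feasible X := by
  rcases h with ⟨h, hX⟩ | ⟨-, hX⟩
  · exact hX.feasible (I.beta_pos hs h.1) h.beta_lt_one hs hc hw
  · exact hX.feasible hs hc hw

/-- The test in `UsesSA1` selects the algorithm whose guarantee attains the maximum in
`approxRatio`. Positive capacities matter here: otherwise SA2 could be chosen for lack of a `β`. -/
theorem IsCSAOutput.mul_opt_le {I : SPSC S V U} (hs : ∀ i, 0 < I.size i)
    (hc : ∀ j, 0 < I.cap j) (hw : ∀ k ∈ I.users, 0 ≤ I.weight k) {X : S → Finset V}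
    (h : I.IsCSAOutput X) : approxRatio I.beta * I.opt ≤ I.reward X := by
  have hc' := fun j => (hc j).le
  have hmin := I.minCap_pos hc
  rcases h with ⟨h, hX⟩ | ⟨h, hX⟩
  · have hle : (1 - Real.exp (-1)) / 4 ≤ 1 - Real.exp (-(1 - √I.beta) ^ 2) :=
      not_lt.1 fun h1 => h.2 (.inr h1)
    rw [approxRatio, if_pos h.beta_lt_one, max_eq_left hle]
    exact hX.mul_opt_le (I.beta_pos hs h.1) h.beta_lt_one hs hc' hw
      (I.size_le_cap_mul_beta hs h.1)
  · have hratio : approxRatio I.beta = (1 - Real.exp (-1)) / 4 := by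
      unfold approxRatio
      split_ifs with h1
      · refine max_eq_right (not_lt.1 fun h2 => h ⟨hmin, ?_⟩)
        rintro (h3 | h3)
        · exact h3.not_gt h1
        · exact lt_asymm h2 h3
      · rfl
    rw [hratio]
    exact hX.mul_opt_le hs hc' hw

theorem Feasible.reward_le_opt {I : SPSC S V U} (hc : ∀ j, 0 ≤ I.cap j) {X : S → Finset V}
    (h : I.Feasible X) : I.reward X ≤ I.opt :=
  (I.isGreatest_opt hc).2 ⟨X, h, rfl⟩

theorem reward_mono (I : SPSC S V U) (hw : ∀ k ∈ I.users, 0 ≤ I.weight k) {X Y : S → Finset V}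
    (h : ∀ i, X i ⊆ Y i) : I.reward X ≤ I.reward Y := by
  refine Finset.sum_le_sum fun k hk => ?_
  have himp : I.Satisfied X k → I.Satisfied Y k :=
    fun hX => hX.mono (Finset.inter_subset_inter_left (h _))
  have := hw k hk
  split_ifs with h1 h2 h2
  exacts [le_rfl, absurd (himp h1) h2, this, le_rfl]

end Combined

/-! ### The repeated algorithm. -/

section Repeated

open scoped Classical

variable {S V U : Type*} [Fintype S] [Fintype V] [Nonempty S] [Nonempty V]

/-- The invariant of the repeated algorithm. -/
structure RSAInvariant (I : SPSC S V U) (s : RSAState S V U) : Prop where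
  users_subset : s.users ⊆ I.users
  cap_nonneg : ∀ j, 0 ≤ s.cap j
  add_cap_le : ∀ j, ∑ i, (if j ∈ s.placement i then I.size i else 0) + s.cap j ≤ I.cap j

theorem rsaInvariant_init (I : SPSC S V U) (hc : ∀ j, 0 ≤ I.cap j) :
    I.RSAInvariant I.rsaInit where
  users_subset := Finset.Subset.refl _
  cap_nonneg := hc
  add_cap_le j := by simp [rsaInit]

theorem RSAInvariant.feasible {I : SPSC S V U} {s : RSAState S V U} (h : I.RSAInvariant s) :
    I.Feasible s.placement := fun j => by
  have := h.add_cap_le j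
  have := h.cap_nonneg j
  linarith

theorem RSAInvariant.step {I : SPSC S V U} (hs : ∀ i, 0 < I.size i)
    (hw : ∀ k ∈ I.users, 0 ≤ I.weight k) {s t : RSAState S V U} (h : I.RSAInvariant s)
    (hst : I.RSAStep s t) : I.RSAInvariant t := by
  obtain ⟨X, hX, hu, hcap, hpl⟩ := hst
  have hfeas := IsCSAOutput.feasible (I := { I with users := s.users, cap := s.cap }) hs
    h.cap_nonneg (fun k hk => hw k (h.users_subset hk)) hX
  refine ⟨?_, fun j => ?_, fun j => ?_⟩
  · rw [hu]
    exact (Finset.filter_subset _ _).trans h.users_subset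
  · rw [hcap, Finset.sum_filter]
    exact sub_nonneg.2 (hfeas j)
  · rw [hcap, Finset.sum_filter]
    -- Only an inequality: a service placed on `j` again occupies its space once, although the
    -- remaining capacity is reduced each time.
    have h1 : ∑ i, (if j ∈ t.placement i then I.size i else 0) ≤
        ∑ i, (if j ∈ s.placement i then I.size i else 0) +
        ∑ i, (if j ∈ X i then I.size i else 0) := by
      rw [← Finset.sum_add_distrib]
      refine Finset.sum_le_sum fun i _ => ?_
      have := hs i
      rw [hpl]
      by_cases h1 : j ∈ s.placement i <;> by_cases h2 : j ∈ X i <;> simp [h1, h2, this.le]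
    have h2 := h.add_cap_le j
    linarith

theorem RSAInvariant.exists_step {I : SPSC S V U} (hs : ∀ i, 0 < I.size i)
    {s : RSAState S V U} (h : I.RSAInvariant s) : ∃ t, I.RSAStep s t := by
  obtain ⟨X, hX⟩ := exists_isCSAOutput { I with users := s.users, cap := s.cap } hs h.cap_nonneg
  exact ⟨⟨_, _, fun i => s.placement i ∪ X i⟩, X, hX, rfl, fun _ => rfl, fun _ => rfl⟩

theorem RSAStep.subset {I : SPSC S V U} {s t : RSAState S V U} (h : I.RSAStep s t) (i : S) :
    s.placement i ⊆ t.placement i := by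
  obtain ⟨X, -, -, -, hpl⟩ := h
  rw [hpl]
  exact Finset.subset_union_left

/-- The placements would increase strictly forever among finitely many. -/
theorem not_forall_rsaStep_ne (I : SPSC S V U) (st : ℕ → RSAState S V U) :
    ¬ ∀ n, I.RSAStep (st n) (st (n + 1)) ∧ (st (n + 1)).placement ≠ (st n).placement := by
  intro h
  have hmono : StrictMono fun n => (st n).placement := strictMono_nat_of_lt_succ fun n =>
    lt_of_le_of_ne (fun i => (h n).1.subset i) (h n).2.symm
  exact not_injective_infinite_finite _ hmono.injective

theorem exists_isRSARun (I : SPSC S V U) (hs : ∀ i, 0 < I.size i) (hc : ∀ j, 0 ≤ I.cap j)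
    (hw : ∀ k ∈ I.users, 0 ≤ I.weight k) : ∃ N st, I.IsRSARun N st := by
  -- The invariant is carried in the subtype, so that the choice function `f` can be iterated.
  have hex : ∀ s : {s // I.RSAInvariant s}, ∃ t : {s // I.RSAInvariant s}, I.RSAStep s t :=
    fun s => let ⟨t, ht⟩ := s.2.exists_step hs
      ⟨⟨t, s.2.step hs hw ht⟩, ht⟩
  choose f hf using hex
  set st : ℕ → RSAState S V U := fun n => (f^[n] ⟨I.rsaInit, I.rsaInvariant_init hc⟩).1
  have hstep : ∀ n, I.RSAStep (st n) (st (n + 1)) := fun n => by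
    simp only [st, Function.iterate_succ_apply']
    exact hf _
  have hfix : ∃ n, (st (n + 1)).placement = (st n).placement := by
    by_contra! hne
    exact I.not_forall_rsaStep_ne st fun n => ⟨hstep n, hne n⟩
  exact ⟨Nat.find hfix, st, rfl, fun n _ => hstep n, fun n hn => Nat.find_min hfix hn,
    Nat.find_spec hfix⟩

theorem RSAInvariant.of_reflTransGen {I : SPSC S V U} (hs : ∀ i, 0 < I.size i)
    (hc : ∀ j, 0 ≤ I.cap j) (hw : ∀ k ∈ I.users, 0 ≤ I.weight k) {s : RSAState S V U}
    (h : Relation.ReflTransGen I.RSAStep I.rsaInit s) : I.RSAInvariant s := by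
  induction h with
  | refl => exact I.rsaInvariant_init hc
  | tail _ hst ih => exact ih.step hs hw hst

theorem RSAStep.isCSAOutput_of_init {I : SPSC S V U} {t : RSAState S V U}
    (h : I.RSAStep I.rsaInit t) : I.IsCSAOutput t.placement := by
  obtain ⟨X, hX, -, -, hpl⟩ := h
  have : t.placement = X := by
    funext i
    rw [hpl]
    exact Finset.empty_union _
  rw [this]
  exact hX

theorem IsRSARun.rsaInvariant {I : SPSC S V U} (hs : ∀ i, 0 < I.size i)
    (hc : ∀ j, 0 ≤ I.cap j) (hw : ∀ k ∈ I.users, 0 ≤ I.weight k) {N : ℕ}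
    {st : ℕ → RSAState S V U} (h : I.IsRSARun N st) : ∀ n ≤ N + 1, I.RSAInvariant (st n) := by
  intro n
  induction n with
  | zero => intro _; rw [h.1]; exact I.rsaInvariant_init hc
  | succ n ih => exact fun hn => (ih (by omega)).step hs hw (h.2.1 n (by omega))

end Repeated

end SPSC

end

theorem mainTheorem3 {S V U : Type*} [Fintype S] [Fintype V] [Nonempty S] [Nonempty V]
    (I : SPSC S V U) (hsize : ∀ i, 0 < I.size i) (hcap : ∀ j, 0 < I.cap j)
    (hweight : ∀ k ∈ I.users, 0 ≤ I.weight k) :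
    -- the combined algorithm returns a placement, with the claimed guarantee
    (∃ X, I.IsCSAOutput X) ∧
    (∀ X, I.IsCSAOutput X → I.IsApprox (SPSC.approxRatio I.beta) X) ∧
    -- the repeated algorithm never gets stuck, always terminates, and so has complete runs
    (∀ s, Relation.ReflTransGen I.RSAStep I.rsaInit s → ∃ t, I.RSAStep s t) ∧
    (¬ ∃ st : ℕ → SPSC.RSAState S V U, st 0 = I.rsaInit ∧
      ∀ n, I.RSAStep (st n) (st (n + 1)) ∧ (st (n + 1)).placement ≠ (st n).placement) ∧
    (∃ N st, I.IsRSARun N st) ∧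
    -- its output has the same guarantee, and no repetition decreases the reward
    (∀ N st, I.IsRSARun N st →
      I.IsApprox (SPSC.approxRatio I.beta) (st (N + 1)).placement ∧
      I.IsCSAOutput (st 1).placement ∧
      (∀ n ≤ N, I.reward (st n).placement ≤ I.reward (st (n + 1)).placement) ∧
      I.reward (st 1).placement ≤ I.reward (st (N + 1)).placement) := by
  have hc := fun j => (hcap j).le
  refine ⟨I.exists_isCSAOutput hsize hc, fun X hX => ?_, fun s h => ?_, ?_,
    I.exists_isRSARun hsize hc hweight, fun N st h => ?_⟩
  · have hfeas := hX.feasible hsize hc hweight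
    exact ⟨hfeas, hX.mul_opt_le hsize hcap hweight, hfeas.reward_le_opt hc⟩
  · exact (SPSC.RSAInvariant.of_reflTransGen hsize hc hweight h).exists_step hsize
  · rintro ⟨st, -, h⟩
    exact I.not_forall_rsaStep_ne st h
  · have hfirst : I.IsCSAOutput (st 1).placement :=
      SPSC.RSAStep.isCSAOutput_of_init (h.1 ▸ h.2.1 0 (Nat.zero_le N))
    have hmono : ∀ n ≤ N, I.reward (st n).placement ≤ I.reward (st (n + 1)).placement :=
      fun n hn => I.reward_mono hweight (h.2.1 n hn).subset
    have hle : ∀ n ≤ N, I.reward (st 1).placement ≤ I.reward (st (n + 1)).placement := by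
      intro n
      induction n with
      | zero => exact fun _ => le_rfl
      | succ n ih => exact fun hn => (ih (by omega)).trans (hmono (n + 1) hn)
    have hfeas := (h.rsaInvariant hsize hc hweight (N + 1) le_rfl).feasible
    -- The ratio comes from the first iteration alone, on the original instance with positive
    -- capacities; later iterations only preserve it.
    exact ⟨⟨hfeas, (hfirst.mul_opt_le hsize hcap hweight).trans (hle N le_rfl),
      hfeas.reward_le_opt hc⟩, hfirst, hmono, hle N le_rfl⟩
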